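/- Let $\Bbbk$ be a commutative ring, $G$ a finite group and $n\ge 0$ an integer. Let $A=\Bbbk G$, let $G_n=G^n\rtimes\mathfrak S_n$ be the wreath product ($\mathfrak S_n$ permuting the factors, $G_0$ trivial), and $A_n=\Bbbk G_n$. Let $V=A^n$ be the permutation representation of $G_n$, with $\Bbbk$-basis $\{ge_i : g\in G,\ 1\le i\le n\}$ and action $\mathbf g\pi\cdot(ae_i)=g_{\pi(i)}a\,e_{\pi(i)}$; let $G_n$ act diagonally on $V^{\otimes k}$ ($V^{\otimes 0}=\Bbbk$ trivial). A $G$-partition of type $\binom lk$ is a pair $(P,\mathbf g)$ of a partition $P$ of $X_k^l=\{1,\dots,k,1',\dots,l'\}$ and a labelling $\mathbf g\in G^{X_k^l}$; $(P,\mathbf g)$ and $(P,\mathbf h)$ are equivalent if on each part of $P$ the labels of $\mathbf h$ are obtained from those of $\mathbf g$ by left multiplication by one element of $G$. The class is written $[P,\mathbf g]$, and its parts are those of $P$. For $d\in\Bbbk$, the category $\mathrm{Par}(G,d)$ has as objects the natural numbers, and $\mathrm{Hom}(k,l)$ is the free $\Bbbk$-module on the classes of $G$-partitions of type $\binom lk$.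 The composite of $[Q,\mathbf h]\colon l\to m$ and $[P,\mathbf g]\colon k\to l$ is $d^{\alpha(Q,P)}[Q\star P,\mathbf h\star\mathbf g]$ if the representatives can be chosen so that the products $g_{j'}h_j^{-1}$ agree for all $j$ lying in one part of $Q$, and $0$ otherwise. Here one stacks $Q$ on $P$ and identifies the middle rows; $Q\star P$ is the partition of the outer rows by connected components, and $\alpha(Q,P)$ is the number of components containing only middle vertices. For such representatives, $\mathbf h\star\mathbf g$ has bottom labels $g_i$ and top labels $u_ih_{i'}$, where $u_i$ is the common value of $g_{j'}h_j^{-1}$ over the $j$ in the part of $i'$ in $Q$ (and $1$ if there is none). Let $\Phi_n\colon\mathrm{Par}(G,n|G|)\to A_n\text{-mod}$ be the action functor: it is $\Bbbk$-linear, $\Phi_n(k)=V^{\otimes k}$, and the matrix coefficient of $\Phi_n([P,\mathbf g])$ from $\bigotimes_{a=1}^k h_ae_{i_a}$ to $\bigotimes_{a=1}^l h_{a'}e_{i_{a'}}$ is $1$ if $i_a=i_b$ and $h_ag_a^{-1}=h_bg_b^{-1}$ whenever $a,b\in X_k^l$ lie in the same part of $P$, and $0$ otherwise. Write $c<c'$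 for two classes of type $\binom lk$ if $c=[P,\mathbf g]$ and $c'=[Q,\mathbf g]$ for some labelling $\mathbf g$ and some partition $Q$ strictly coarser than $P$, and define $x_c\in\mathrm{Hom}(k,l)$ recursively by $x_c=c-\sum_{c'>c}x_{c'}$. **Theorem.** (a) The functor $\Phi_n$ is full: every $G_n$-equivariant linear map $V^{\otimes k}\to V^{\otimes l}$ is in the image of $\Phi_n$, for all $k,l\ge 0$. (b) For all $k,l\ge 0$, the kernel of $\Phi_n\colon\mathrm{Hom}_{\mathrm{Par}(G,n|G|)}(k,l)\to\mathrm{Hom}_{G_n}(V^{\otimes k},V^{\otimes l})$ is the $\Bbbk$-span of the $x_{[P,\mathbf g]}$ with $[P,\mathbf g]$ of type $\binom lk$ having more than $n$ parts. In particular, if $\Bbbk\ne 0$, this map is an isomorphism if and only if $k+l\le n$. -/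

import Mathlib

namespace GroupPartition

open CategoryTheory
open scoped Classical

universe u v

/-- The vertex set `{1, …, k, 1', …, l'}`: `Sum.inl` is the bottom row, `Sum.inr` the top row. -/
abbrev Vertex (k l : ℕ) : Type := Fin k ⊕ Fin l

/-- A `G`-partition `(P, g)` with `k` bottom and `l` top vertices: a partition `P` of the vertex
set (given as the equivalence relation "in the same part") and a label in `G` at every vertex. -/
structure GPartition (G : Type v) (k l : ℕ) where
  /-- the underlying partition -/
  part : Setoid (Vertex k l)
  /-- the labels of the vertices -/
  label : Vertex k l → G

section Diagrams

variable {G : Type v} [Group G]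

/-- Two `G`-partitions are equivalent if they have the same underlying partition and, on every
part, the labels differ by left multiplication by one element of `G`. -/
def GPartition.Equivalent {k l : ℕ} (p q : GPartition G k l) : Prop :=
  p.part = q.part ∧
    ∃ t : Quotient p.part → G, ∀ a, q.label a = t (Quotient.mk p.part a) * p.label a

instance gpartitionSetoid (G : Type v) [Group G] (k l : ℕ) : Setoid (GPartition G k l) where
  r := GPartition.Equivalent
  iseqv := by
    refine ⟨fun p => ⟨rfl, fun _ => 1, fun a => by simp⟩, ?_, ?_⟩
    · rintro ⟨P, g⟩ ⟨Q, h⟩ ⟨rfl, t, ht⟩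
      refine ⟨rfl, fun c => (t c)⁻¹, fun a => ?_⟩
      have := ht a
      dsimp only at this ⊢
      rw [this]; group
    · rintro ⟨P, g⟩ ⟨Q, h⟩ ⟨R, f⟩ ⟨rfl, t, ht⟩ ⟨rfl, s, hs⟩
      refine ⟨rfl, fun c => s c * t c, fun a => ?_⟩
      have h1 := ht a
      have h2 := hs a
      dsimp only at h1 h2 ⊢
      rw [h2, h1]; group

/-- `G`-partition diagrams from `k` to `l`: equivalence classes `[P, g]` of `G`-partitions. -/
def Diagram (G : Type v) [Group G] (k l : ℕ) : Type v := Quotient (gpartitionSetoid G k l)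

/-- The class `[P, g]`. -/
def Diagram.mk {k l : ℕ} (P : Setoid (Vertex k l)) (g : Vertex k l → G) : Diagram G k l :=
  Quotient.mk (gpartitionSetoid G k l) ⟨P, g⟩

theorem Diagram.mk_eq_mk {k l : ℕ} {P Q : Setoid (Vertex k l)} {g h : Vertex k l → G} :
    Diagram.mk P g = Diagram.mk Q h ↔
      GPartition.Equivalent (⟨P, g⟩ : GPartition G k l) ⟨Q, h⟩ :=
  Quotient.eq (r := gpartitionSetoid G k l)

theorem Diagram.ind {k l : ℕ} {motive : Diagram G k l → Prop}
    (h : ∀ P g, motive (Diagram.mk P g)) (c : Diagram G k l) : motive c :=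
  Quotient.ind (fun p => h p.part p.label) c

/-- The underlying partition of `[P, g]`. -/
def Diagram.part {k l : ℕ} (c : Diagram G k l) : Setoid (Vertex k l) :=
  Quotient.lift (fun p : GPartition G k l => p.part) (fun p q (h : p.Equivalent q) => h.1) c

/-- The number of parts of `[P, g]`. -/
noncomputable def Diagram.numParts {k l : ℕ} (c : Diagram G k l) : ℕ :=
  Nat.card (Quotient c.part)

/-! ### Stacking and composition -/

/-- Vertices of the three-row diagram: bottom, middle and top row. -/
abbrev StackVertex (k l m : ℕ) : Type := Fin k ⊕ Fin l ⊕ Fin m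

/-- A vertex of the lower diagram, inside the stack. -/
def lower {k l : ℕ} (m : ℕ) : Vertex k l → StackVertex k l m :=
  Sum.elim Sum.inl (fun j => Sum.inr (Sum.inl j))

/-- A vertex of the upper diagram, inside the stack. -/
def upper (k : ℕ) {l m : ℕ} : Vertex l m → StackVertex k l m :=
  Sum.elim (fun j => Sum.inr (Sum.inl j)) (fun i => Sum.inr (Sum.inr i))

/-- The bottom and top rows of the stack. -/
def outer {k m : ℕ} (l : ℕ) : Vertex k m → StackVertex k l m :=
  Sum.elim Sum.inl (fun i => Sum.inr (Sum.inr i))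

/-- The edges of `stack(Q, P)`. -/
def stackEdge {k l m : ℕ} (Q : Setoid (Vertex l m)) (P : Setoid (Vertex k l))
    (v w : StackVertex k l m) : Prop :=
  (∃ a b, P a b ∧ lower m a = v ∧ lower m b = w) ∨ (∃ a b, Q a b ∧ upper k a = v ∧ upper k b = w)

/-- The relation "in the same connected component of `stack(Q, P)`". -/
def stack {k l m : ℕ} (Q : Setoid (Vertex l m)) (P : Setoid (Vertex k l)) :
    Setoid (StackVertex k l m) :=
  Relation.EqvGen.setoid (stackEdge Q P)

/-- The partition `Q ⋆ P`. -/
def star {k l m : ℕ} (Q : Setoid (Vertex l m)) (P : Setoid (Vertex k l)) : Setoid (Vertex k m) :=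
  (stack Q P).comap (outer l)

/-- The number `α(Q, P)` of components of the stack that contain only middle vertices. -/
noncomputable def alpha {k l m : ℕ} (Q : Setoid (Vertex l m)) (P : Setoid (Vertex k l)) : ℕ :=
  Nat.card {c : Quotient (stack Q P) //
    ∀ v : StackVertex k l m, Quotient.mk (stack Q P) v = c → ∃ j : Fin l, v = Sum.inr (Sum.inl j)}

/-- `((Q, h), (P, g))` is compatible if the labels `g_{j'} h_j⁻¹` of the middle vertices agree on
middle vertices lying in one part of `Q`. -/
def Compatible {k l m : ℕ} (q : GPartition G l m) (p : GPartition G k l) : Prop :=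
  ∀ i j : Fin l, q.part (Sum.inl i) (Sum.inl j) →
    p.label (Sum.inr i) * (q.label (Sum.inl i))⁻¹ = p.label (Sum.inr j) * (q.label (Sum.inl j))⁻¹

/-- The labels `h ⋆ g`: bottom labels are those of `(P, g)`; a top label `h_{i'}` is multiplied on
the left by the common label of the middle vertices in its part of `Q` (by `1` if there are
none). -/
noncomputable def starLabel {k l m : ℕ} (q : GPartition G l m) (p : GPartition G k l) :
    Vertex k m → G :=
  Sum.elim (fun i => p.label (Sum.inl i)) (fun i =>
    (if h : ∃ j : Fin l, q.part (Sum.inl j) (Sum.inr i) then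
      p.label (Sum.inr h.choose) * (q.label (Sum.inl h.choose))⁻¹ else 1) * q.label (Sum.inr i))

/-- The composite of two `G`-partition diagrams: `none` if the pair is not compatible, and
otherwise the exponent `α(Q, P)` together with `[Q ⋆ P, h ⋆ g]`, computed from a compatible pair
of representatives (see `starData_eq` for the independence of the choice). -/
noncomputable def starData {k l m : ℕ} (c' : Diagram G l m) (c : Diagram G k l) :
    Option (ℕ × Diagram G k m) :=
  if h : ∃ r : GPartition G l m × GPartition G k l,
      Diagram.mk r.1.part r.1.label = c' ∧ Diagram.mk r.2.part r.2.label = c ∧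
        Compatible r.1 r.2 then
    some (alpha h.choose.1.part h.choose.2.part,
      Diagram.mk (star h.choose.1.part h.choose.2.part) (starLabel h.choose.1 h.choose.2))
  else none

/-! ### Matrix coefficients -/

/-- The condition on basis vectors `h_a e_{i_a}` (encoded as pairs `(i_a, h_a)`) placed at the
vertices for which the matrix coefficient of `(P, g)` is `1`: whenever `a` and `b` lie in the same
part, `i_a = i_b` and `h_a g_a⁻¹ = h_b g_b⁻¹`. -/
def GPartition.Admits {k l n : ℕ} (p : GPartition G k l) (x : Vertex k l → Fin n × G) : Prop :=
  ∀ a b, p.part a b →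
    (x a).1 = (x b).1 ∧ (x a).2 * (p.label a)⁻¹ = (x b).2 * (p.label b)⁻¹

theorem GPartition.Admits.of_equivalent {k l n : ℕ} {p q : GPartition G k l}
    {x : Vertex k l → Fin n × G} (h : p.Equivalent q) (hp : p.Admits x) : q.Admits x := by
  obtain ⟨P, g⟩ := p
  obtain ⟨Q, h'⟩ := q
  obtain ⟨h1, t, ht⟩ := h
  dsimp only at h1 t ht
  subst h1
  intro a b hab
  refine ⟨(hp a b hab).1, ?_⟩
  have h2 := (hp a b hab).2
  have h3 : (Quotient.mk P a) = Quotient.mk P b := Quotient.sound hab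
  simp only [ht, h3, mul_inv_rev, ← mul_assoc] at h2 ⊢
  rw [h2]

/-- The matrix coefficient condition for the class `[P, g]`. -/
def Diagram.Admits {k l n : ℕ} (c : Diagram G k l) (x : Vertex k l → Fin n × G) : Prop :=
  Quotient.lift (fun p : GPartition G k l => p.Admits x)
    (fun _ _ h => propext ⟨fun hp => hp.of_equivalent h,
      fun hp => hp.of_equivalent ((gpartitionSetoid G k l).symm h)⟩) c

theorem Diagram.mk_admits {k l n : ℕ} (P : Setoid (Vertex k l)) (g : Vertex k l → G)
    (x : Vertex k l → Fin n × G) :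
    (Diagram.mk P g).Admits x ↔ (⟨P, g⟩ : GPartition G k l).Admits x := Iff.rfl

/-- The matrix coefficient of `[P, g]` in the column `x` and the row `y`. -/
noncomputable def Diagram.coeff (R : Type u) [Zero R] [One R] {k l n : ℕ} (c : Diagram G k l)
    (x : Fin k → Fin n × G) (y : Fin l → Fin n × G) : R :=
  if c.Admits (Sum.elim x y) then 1 else 0

/-! ### The partial order on diagrams -/

/-- `c < c'` if `c = [P, g]` and `c' = [Q, g]` for some labelling `g` and some partition `Q`
strictly coarser than `P`. All representatives `g` of `c` are allowed, so that this does not depend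
on a choice. -/
def Diagram.StrictlyFiner {k l : ℕ} (c c' : Diagram G k l) : Prop :=
  ∃ (P Q : Setoid (Vertex k l)) (g : Vertex k l → G),
    P < Q ∧ c = Diagram.mk P g ∧ c' = Diagram.mk Q g

theorem Diagram.part_lt {k l : ℕ} {c c' : Diagram G k l} (h : c.StrictlyFiner c') :
    c.part < c'.part := by
  obtain ⟨P, Q, g, h, rfl, rfl⟩ := h
  exact h

instance finite_setoid (k l : ℕ) : Finite (Setoid (Vertex k l)) :=
  Finite.of_injective (fun s => (fun a b => s a b : Vertex k l → Vertex k l → Prop))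
    (fun s t h => Setoid.ext (fun a b => by
      have := congrFun (congrFun h a) b
      simpa using this))

instance finite_diagram [Finite G] (k l : ℕ) : Finite (Diagram G k l) := by
  have : Finite (GPartition G k l) :=
    Finite.of_injective (fun p => (p.part, p.label)) (fun p q h => by
      cases p; cases q; simp_all)
  exact Quotient.finite _

noncomputable instance fintype_diagram [Finite G] (k l : ℕ) : Fintype (Diagram G k l) :=
  Fintype.ofFinite _

/-- The elements `x_{[P, g]}`, defined by downward recursion along the order on diagrams:
`x_c = c - ∑_{c' > c} x_{c'}`. -/
noncomputable def xElem (𝕜 : Type u) [CommRing 𝕜] [Finite G] {k l : ℕ} (c : Diagram G k l) :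
    Diagram G k l →₀ 𝕜 :=
  Finsupp.single c 1 - ∑ c' : {c' : Diagram G k l // c.StrictlyFiner c'}, xElem 𝕜 c'.1
termination_by wellFounded_gt.wrap c.part
decreasing_by exact Diagram.part_lt c'.2

theorem xElem_def (𝕜 : Type u) [CommRing 𝕜] [Finite G] {k l : ℕ} (c : Diagram G k l) :
    xElem 𝕜 c = Finsupp.single c 1 -
      ∑ c' : {c' : Diagram G k l // c.StrictlyFiner c'}, xElem 𝕜 c'.1 := by
  rw [xElem]

/-! ### Composition of matrix coefficients -/

theorem stack_lower {k l m : ℕ} {Q : Setoid (Vertex l m)} {P : Setoid (Vertex k l)}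
    {a b : Vertex k l} (h : P a b) : stack Q P (lower m a) (lower m b) :=
  Relation.EqvGen.rel _ _ (Or.inl ⟨a, b, h, rfl, rfl⟩)

theorem stack_upper {k l m : ℕ} {Q : Setoid (Vertex l m)} {P : Setoid (Vertex k l)}
    {a b : Vertex l m} (h : Q a b) : stack Q P (upper k a) (upper k b) :=
  Relation.EqvGen.rel _ _ (Or.inr ⟨a, b, h, rfl, rfl⟩)

/-- A function that is constant along both partitions is constant on components of the stack. -/
theorem stack_const {α : Type*} {k l m : ℕ} {Q : Setoid (Vertex l m)} {P : Setoid (Vertex k l)}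
    (f : StackVertex k l m → α) (hP : ∀ a b, P a b → f (lower m a) = f (lower m b))
    (hQ : ∀ a b, Q a b → f (upper k a) = f (upper k b)) {v w : StackVertex k l m}
    (h : stack Q P v w) : f v = f w := by
  have h' : Relation.EqvGen (stackEdge Q P) v w := h
  clear h
  induction h' with
  | rel v w h =>
    rcases h with ⟨a, b, h, rfl, rfl⟩ | ⟨a, b, h, rfl, rfl⟩
    · exact hP a b h
    · exact hQ a b h
  | refl => rfl
  | symm v w h ih => exact ih.symm
  | trans u v w h1 h2 ih1 ih2 => exact ih1.trans ih2

/-- Divide the group component by `g` on the right. -/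
def tw {n : ℕ} (s : Fin n × G) (g : G) : Fin n × G := (s.1, s.2 * g⁻¹)

theorem GPartition.admits_iff {k l n : ℕ} (p : GPartition G k l) (x : Vertex k l → Fin n × G) :
    p.Admits x ↔ ∀ a b, p.part a b → tw (x a) (p.label a) = tw (x b) (p.label b) := by
  simp only [GPartition.Admits, tw, Prod.mk.injEq]

/-- The label of the middle vertices in the part of a vertex of the upper partition. -/
noncomputable def partLabel {k l m : ℕ} (q : GPartition G l m) (p : GPartition G k l)
    (a : Vertex l m) : G :=
  if h : ∃ j : Fin l, q.part (Sum.inl j) a then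
      p.label (Sum.inr h.choose) * (q.label (Sum.inl h.choose))⁻¹ else 1

theorem partLabel_const {k l m : ℕ} {q : GPartition G l m} {p : GPartition G k l}
    (hc : Compatible q p) {a b : Vertex l m} (h : q.part a b) :
    partLabel q p a = partLabel q p b := by
  unfold partLabel
  by_cases ha : ∃ j : Fin l, q.part (Sum.inl j) a
  · have hb : ∃ j : Fin l, q.part (Sum.inl j) b := ⟨ha.choose, q.part.trans ha.choose_spec h⟩
    rw [dif_pos ha, dif_pos hb]
    exact hc _ _ (q.part.trans ha.choose_spec
      (q.part.trans h (q.part.symm hb.choose_spec)))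
  · have hb : ¬ ∃ j : Fin l, q.part (Sum.inl j) b :=
      fun ⟨j, hj⟩ => ha ⟨j, q.part.trans hj (q.part.symm h)⟩
    rw [dif_neg ha, dif_neg hb]

theorem partLabel_mid {k l m : ℕ} {q : GPartition G l m} {p : GPartition G k l}
    (hc : Compatible q p) (j : Fin l) :
    partLabel q p (Sum.inl j) * q.label (Sum.inl j) = p.label (Sum.inr j) := by
  have hb : ∃ j' : Fin l, q.part (Sum.inl j') (Sum.inl j) := ⟨j, q.part.refl _⟩
  unfold partLabel
  rw [dif_pos hb, hc _ _ hb.choose_spec]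
  group

/-- The labels on the whole stack after normalizing all middle labels to `1`. -/
noncomputable def stackLabel {k l m : ℕ} (q : GPartition G l m) (p : GPartition G k l) :
    StackVertex k l m → G :=
  Sum.elim (fun i => p.label (Sum.inl i)) (Sum.elim (fun j => p.label (Sum.inr j))
    (fun i => partLabel q p (Sum.inr i) * q.label (Sum.inr i)))

theorem stackLabel_lower {k l m : ℕ} (q : GPartition G l m) (p : GPartition G k l)
    (a : Vertex k l) : stackLabel q p (lower m a) = p.label a := by
  rcases a with a | a <;> rfl

theorem stackLabel_upper {k l m : ℕ} {q : GPartition G l m} {p : GPartition G k l}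
    (hc : Compatible q p) (a : Vertex l m) :
    stackLabel q p (upper k a) = partLabel q p a * q.label a := by
  rcases a with a | a
  · exact (partLabel_mid hc a).symm
  · rfl

theorem stackLabel_outer {k l m : ℕ} (q : GPartition G l m) (p : GPartition G k l)
    (a : Vertex k m) : stackLabel q p (outer l a) = starLabel q p a := by
  rcases a with a | a <;> rfl

/-- Entries on all three rows. -/
def stackState {k l m : ℕ} {α : Type*} (x : Fin k → α) (y : Fin l → α) (z : Fin m → α) :
    StackVertex k l m → α := Sum.elim x (Sum.elim y z)

theorem stackState_lower {k l m : ℕ} {α : Type*} (x : Fin k → α) (y : Fin l → α) (z : Fin m → α)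
    (a : Vertex k l) : stackState x y z (lower m a) = Sum.elim x y a := by
  rcases a with a | a <;> rfl

theorem stackState_upper {k l m : ℕ} {α : Type*} (x : Fin k → α) (y : Fin l → α) (z : Fin m → α)
    (a : Vertex l m) : stackState x y z (upper k a) = Sum.elim y z a := by
  rcases a with a | a <;> rfl

theorem stackState_outer {k l m : ℕ} {α : Type*} (x : Fin k → α) (y : Fin l → α) (z : Fin m → α)
    (a : Vertex k m) : stackState x y z (outer l a) = Sum.elim x z a := by
  rcases a with a | a <;> rfl

theorem tw_mul_left {n : ℕ} {s t : Fin n × G} {g h e : G} :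
    tw s (e * g) = tw t (e * h) ↔ tw s g = tw t h := by
  simp [tw, Prod.ext_iff, mul_inv_rev, ← mul_assoc]

theorem tw_tw {n : ℕ} (s : Fin n × G) (g : G) : tw (tw s g⁻¹) g = s := by
  simp [tw]

theorem tw_tw' {n : ℕ} (s : Fin n × G) (g : G) : tw (tw s g) g⁻¹ = s := by
  simp [tw]

theorem tw_inj {n : ℕ} {s t : Fin n × G} {g : G} (h : tw s g = tw t g) : s = t := by
  rw [← tw_tw' s g, h, tw_tw']

theorem admits_stack {k l m n : ℕ} {q : GPartition G l m} {p : GPartition G k l}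
    (hc : Compatible q p) (x : Fin k → Fin n × G) (y : Fin l → Fin n × G)
    (z : Fin m → Fin n × G) :
    (p.Admits (Sum.elim x y) ∧ q.Admits (Sum.elim y z)) ↔
      ∀ v w, stack q.part p.part v w →
        tw (stackState x y z v) (stackLabel q p v) =
          tw (stackState x y z w) (stackLabel q p w) := by
  rw [GPartition.admits_iff, GPartition.admits_iff]
  constructor
  · rintro ⟨h1, h2⟩ v w hvw
    refine stack_const (fun v => tw (stackState x y z v) (stackLabel q p v)) ?_ ?_ hvw
    · intro a b hab
      simp only [stackState_lower, stackLabel_lower]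
      exact h1 a b hab
    · intro a b hab
      simp only [stackState_upper, stackLabel_upper hc]
      rw [partLabel_const hc hab, tw_mul_left]
      exact h2 a b hab
  · intro h
    refine ⟨fun a b hab => ?_, fun a b hab => ?_⟩
    · have := h _ _ (stack_lower (Q := q.part) hab)
      simpa only [stackState_lower, stackLabel_lower] using this
    · have := h _ _ (stack_upper (P := p.part) hab)
      simp only [stackState_upper, stackLabel_upper hc] at this
      rwa [partLabel_const hc hab, tw_mul_left] at this

/-- The starred `G`-partition. -/
noncomputable def starGP {k l m : ℕ} (q : GPartition G l m) (p : GPartition G k l) :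
    GPartition G k m := ⟨star q.part p.part, starLabel q p⟩

theorem starGP_admits {k l m n : ℕ} {q : GPartition G l m} {p : GPartition G k l}
    (x : Fin k → Fin n × G) (y : Fin l → Fin n × G) (z : Fin m → Fin n × G)
    (h : ∀ v w, stack q.part p.part v w →
        tw (stackState x y z v) (stackLabel q p v) =
          tw (stackState x y z w) (stackLabel q p w)) :
    (starGP q p).Admits (Sum.elim x z) := by
  rw [GPartition.admits_iff]
  intro a b hab
  have := h _ _ (show stack q.part p.part (outer l a) (outer l b) from hab)
  simp only [stackState_outer, stackLabel_outer] at this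
  exact this

/-- The property of a component of containing only middle vertices. -/
def MidOnly {k l m : ℕ} (Q : Setoid (Vertex l m)) (P : Setoid (Vertex k l))
    (c : Quotient (stack Q P)) : Prop :=
  ∀ v : StackVertex k l m, Quotient.mk (stack Q P) v = c → ∃ j : Fin l, v = Sum.inr (Sum.inl j)

theorem exists_outer {k l m : ℕ} {Q : Setoid (Vertex l m)} {P : Setoid (Vertex k l)}
    {c : Quotient (stack Q P)} (h : ¬ MidOnly Q P c) :
    ∃ a : Vertex k m, Quotient.mk (stack Q P) (outer l a) = c := by
  unfold MidOnly at h
  push Not at h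
  obtain ⟨v, hv, h⟩ := h
  rcases v with i | j | i
  · exact ⟨Sum.inl i, hv⟩
  · exact absurd rfl (h j)
  · exact ⟨Sum.inr i, hv⟩

theorem not_midOnly_outer {k l m : ℕ} (Q : Setoid (Vertex l m)) (P : Setoid (Vertex k l))
    (a : Vertex k m) : ¬ MidOnly Q P (Quotient.mk (stack Q P) (outer l a)) := by
  intro h
  obtain ⟨j, hj⟩ := h _ rfl
  rcases a with a | a <;> simp [outer] at hj

/-- The value on each component. -/
noncomputable def compValue {k l m n : ℕ} (q : GPartition G l m) (p : GPartition G k l)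
    (x : Fin k → Fin n × G) (z : Fin m → Fin n × G)
    (φ : {c : Quotient (stack q.part p.part) // MidOnly q.part p.part c} → Fin n × G)
    (c : Quotient (stack q.part p.part)) : Fin n × G :=
  if h : MidOnly q.part p.part c then φ ⟨c, h⟩ else
    tw (Sum.elim x z (exists_outer h).choose) (starLabel q p (exists_outer h).choose)

theorem compValue_outer {k l m n : ℕ} {q : GPartition G l m} {p : GPartition G k l}
    {x : Fin k → Fin n × G} {z : Fin m → Fin n × G}
    (h : (starGP q p).Admits (Sum.elim x z))
    (φ : {c : Quotient (stack q.part p.part) // MidOnly q.part p.part c} → Fin n × G)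
    (a : Vertex k m) :
    compValue q p x z φ (Quotient.mk _ (outer l a)) = tw (Sum.elim x z a) (starLabel q p a) := by
  have h1 := not_midOnly_outer q.part p.part a
  unfold compValue
  rw [dif_neg h1]
  rw [GPartition.admits_iff] at h
  have h2 : stack q.part p.part (outer l (exists_outer h1).choose) (outer l a) :=
    Quotient.exact (exists_outer h1).choose_spec
  exact h _ _ h2

/-- Completions of outer entries to the middle row are functions on the inner components. -/
noncomputable def completions {k l m n : ℕ} {q : GPartition G l m} {p : GPartition G k l}
    {x : Fin k → Fin n × G} {z : Fin m → Fin n × G}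
    (h : (starGP q p).Admits (Sum.elim x z)) :
    {y : Fin l → Fin n × G // ∀ v w, stack q.part p.part v w →
        tw (stackState x y z v) (stackLabel q p v) =
          tw (stackState x y z w) (stackLabel q p w)} ≃
      ({c : Quotient (stack q.part p.part) // MidOnly q.part p.part c} → Fin n × G) where
  toFun y c := Quotient.lift (fun v => tw (stackState x y.1 z v) (stackLabel q p v))
    (fun v w hvw => y.2 v w hvw) c.1
  invFun φ := ⟨fun j => tw (compValue q p x z φ (Quotient.mk _ (Sum.inr (Sum.inl j))))
      (p.label (Sum.inr j))⁻¹, by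
    have key : ∀ v, tw (stackState x (fun j => tw (compValue q p x z φ
        (Quotient.mk _ (Sum.inr (Sum.inl j)))) (p.label (Sum.inr j))⁻¹) z v)
          (stackLabel q p v) = compValue q p x z φ (Quotient.mk _ v) := by
      intro v
      rcases v with i | j | i
      · exact (compValue_outer h φ (Sum.inl i)).symm
      · exact tw_tw _ _
      · exact (compValue_outer h φ (Sum.inr i)).symm
    intro v w hvw
    rw [key, key, Quotient.sound hvw]⟩
  left_inv y := by
    obtain ⟨y, hy⟩ := y
    apply Subtype.ext
    funext j
    simp only
    apply tw_inj (g := p.label (Sum.inr j))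
    rw [tw_tw]
    by_cases hm : MidOnly q.part p.part (Quotient.mk _ (Sum.inr (Sum.inl j)))
    · unfold compValue
      rw [dif_pos hm]
      rfl
    · obtain ⟨a, ha⟩ := exists_outer hm
      rw [← ha, compValue_outer h]
      have := hy _ _ (Quotient.exact ha)
      simp only [stackState_outer, stackLabel_outer] at this
      exact this
  right_inv φ := by
    funext ⟨c, hc⟩
    obtain ⟨v, rfl⟩ := Quotient.exists_rep c
    obtain ⟨j, rfl⟩ := hc v rfl
    simp only [Quotient.lift_mk]
    refine (tw_tw _ _).trans ?_
    unfold compValue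
    rw [dif_pos hc]

theorem sum_coeff_gp [Fintype G] {k l m n : ℕ} {q : GPartition G l m} {p : GPartition G k l}
    (hc : Compatible q p) (R : Type u) [CommSemiring R] (x : Fin k → Fin n × G)
    (z : Fin m → Fin n × G) :
    (∑ y : Fin l → Fin n × G, (if p.Admits (Sum.elim x y) then (1 : R) else 0) *
      (if q.Admits (Sum.elim y z) then 1 else 0)) =
      ((n : R) * Fintype.card G) ^ alpha q.part p.part *
        (if (starGP q p).Admits (Sum.elim x z) then 1 else 0) := by
  have hite : ∀ y : Fin l → Fin n × G, (if p.Admits (Sum.elim x y) then (1 : R) else 0) *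
      (if q.Admits (Sum.elim y z) then 1 else 0) =
      if (∀ v w, stack q.part p.part v w → tw (stackState x y z v) (stackLabel q p v) =
          tw (stackState x y z w) (stackLabel q p w)) then 1 else 0 := by
    intro y
    rw [ite_zero_mul_ite_zero, mul_one]
    exact if_congr (admits_stack hc x y z) rfl rfl
  rw [Finset.sum_congr rfl (fun y _ => hite y), Finset.sum_boole]
  by_cases h : (starGP q p).Admits (Sum.elim x z)
  · rw [if_pos h, mul_one, ← Fintype.card_subtype, Fintype.card_congr (completions h),
      Fintype.card_fun, Fintype.card_prod, Fintype.card_fin, Fintype.card_eq_nat_card (α := {c // _})]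
    push_cast
    rfl
  · rw [if_neg h, mul_zero, Finset.filter_false_of_mem, Finset.card_empty, Nat.cast_zero]
    intro y _ hy
    exact h (starGP_admits x y z hy)

theorem compatible_of_admits {k l m n : ℕ} {c' : Diagram G l m} {c : Diagram G k l}
    {x : Fin k → Fin n × G} {y : Fin l → Fin n × G} {z : Fin m → Fin n × G}
    (h : c.Admits (Sum.elim x y)) (h' : c'.Admits (Sum.elim y z)) :
    ∃ r : GPartition G l m × GPartition G k l,
      Diagram.mk r.1.part r.1.label = c' ∧ Diagram.mk r.2.part r.2.label = c ∧
        Compatible r.1 r.2 := by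
  have key : ∀ {k l : ℕ} (c : Diagram G k l) (u : Vertex k l → Fin n × G), c.Admits u →
      Diagram.mk c.part (fun a => (u a).2) = c := by
    intro k l c u
    induction c using Diagram.ind with | h P g => ?_
    intro h
    refine Diagram.mk_eq_mk.2 ⟨rfl, Quotient.lift (fun a => g a * (u a).2⁻¹) ?_, ?_⟩
    · intro a b hab
      have h2 := (h a b hab).2
      dsimp only at h2
      rw [← inv_inj] at h2
      simpa using h2
    · intro a
      simp
  refine ⟨⟨⟨c'.part, fun a => (Sum.elim y z a).2⟩, ⟨c.part, fun a => (Sum.elim x y a).2⟩⟩,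
    key c' _ h', key c _ h, ?_⟩
  intro i j _
  simp

/-- The value of an element of `Option (ℕ × Diagram)` on entries. -/
noncomputable def evalData [Fintype G] (R : Type u) [CommSemiring R] {k m n : ℕ}
    (r : Option (ℕ × Diagram G k m)) (x : Fin k → Fin n × G) (z : Fin m → Fin n × G) : R :=
  match r with
  | none => 0
  | some (a, e) => ((n : R) * Fintype.card G) ^ a * e.coeff R x z

theorem evalData_starData [Fintype G] (R : Type u) [CommSemiring R] {k l m n : ℕ}
    (c' : Diagram G l m) (c : Diagram G k l) (x : Fin k → Fin n × G) (z : Fin m → Fin n × G) :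
    evalData R (starData c' c) x z = ∑ y : Fin l → Fin n × G, c.coeff R x y * c'.coeff R y z := by
  unfold starData
  by_cases h : ∃ r : GPartition G l m × GPartition G k l,
      Diagram.mk r.1.part r.1.label = c' ∧ Diagram.mk r.2.part r.2.label = c ∧
        Compatible r.1 r.2
  · rw [dif_pos h]
    have h1 := h.choose_spec
    have := sum_coeff_gp (n := n) h1.2.2 R x z
    refine Eq.trans ?_ (this.symm.trans ?_)
    · rfl
    · refine Finset.sum_congr rfl (fun y _ => ?_)
      have e1 : c.coeff R x y = (Diagram.mk h.choose.2.part h.choose.2.label).coeff R x y := by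
        rw [h1.2.1]
      have e2 : c'.coeff R y z = (Diagram.mk h.choose.1.part h.choose.1.label).coeff R y z := by
        rw [h1.1]
      rw [e1, e2]
      rfl
  · rw [dif_neg h]
    symm
    refine Finset.sum_eq_zero (fun y _ => ?_)
    unfold Diagram.coeff
    by_cases h1 : c.Admits (Sum.elim x y)
    · by_cases h2 : c'.Admits (Sum.elim y z)
      · exact absurd (compatible_of_admits h1 h2) h
      · rw [if_neg h2, mul_zero]
    · rw [if_neg h1, zero_mul]

/-- Entries in general position detect a diagram up to refinement. -/
theorem exists_generic {k m n : ℕ} (hn : k + m ≤ n) (e : Diagram G k m) :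
    ∃ (x : Fin k → Fin n × G) (z : Fin m → Fin n × G), e.Admits (Sum.elim x z) ∧
      ∀ e' : Diagram G k m, e'.Admits (Sum.elim x z) →
        ∃ g, e' = Diagram.mk e'.part g ∧ e = Diagram.mk e.part g ∧ e'.part ≤ e.part := by
  induction e using Diagram.ind with | h P g => ?_
  have hcard : Nat.card (Quotient P) ≤ n :=
    (Nat.card_le_card_of_surjective _ (Quotient.mk_surjective (s := P))).trans (by simpa using hn)
  have : Nonempty (Quotient P ↪ Fin n) := by
    have := Fintype.ofFinite (Quotient P)
    rw [Function.Embedding.nonempty_iff_card_le]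
    simpa using hcard
  obtain ⟨ι⟩ := this
  refine ⟨fun i => (ι (Quotient.mk P (Sum.inl i)), g (Sum.inl i)),
    fun i => (ι (Quotient.mk P (Sum.inr i)), g (Sum.inr i)), ?_⟩
  have hu : (Sum.elim (fun i => (ι (Quotient.mk P (Sum.inl i)), g (Sum.inl i)))
    (fun i => (ι (Quotient.mk P (Sum.inr i)), g (Sum.inr i))) : Vertex k m → Fin n × G) =
      fun a => (ι (Quotient.mk P a), g a) := by
    funext a
    rcases a with a | a <;> rfl
  rw [hu]
  constructor
  · intro a b hab
    have : Quotient.mk P a = Quotient.mk P b := Quotient.sound hab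
    simp [this]
  · intro e'
    induction e' using Diagram.ind with | h P' g' => ?_
    intro h
    refine ⟨g, ?_, rfl, ?_⟩
    · refine Diagram.mk_eq_mk.2 ⟨rfl, Quotient.lift (fun a => g a * (g' a)⁻¹) ?_, ?_⟩
      · intro a b hab
        exact (h a b hab).2
      · intro a
        simp
    · intro a b hab
      exact Quotient.exact (ι.injective (h a b hab).1)

theorem evalData_injective [Fintype G] {k m : ℕ} {r r' : Option (ℕ × Diagram G k m)}
    (h : ∀ (n : ℕ) (x : Fin k → Fin n × G) (z : Fin m → Fin n × G),
      evalData ℕ r x z = evalData ℕ r' x z) : r = r' := by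
  have hb : 1 < (k + m + 2) * Fintype.card G := by
    have := Fintype.card_pos (α := G)
    nlinarith
  have key : ∀ (r r' : Option (ℕ × Diagram G k m)), (∀ (n : ℕ) (x : Fin k → Fin n × G)
      (z : Fin m → Fin n × G), evalData ℕ r x z = evalData ℕ r' x z) → ∀ s, r = some s →
      ∃ s', r' = some s' ∧ s.1 = s'.1 ∧
        ∃ g, s'.2 = Diagram.mk s'.2.part g ∧ s.2 = Diagram.mk s.2.part g ∧
          s'.2.part ≤ s.2.part := by
    rintro r r' h ⟨a, e⟩ rfl
    obtain ⟨x, z, h1, h2⟩ := exists_generic (n := k + m + 2) (by omega) e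
    have h3 := h _ x z
    have h4 : ((k + m + 2 : ℕ) * Fintype.card G) ^ a = evalData ℕ r' x z := by
      rw [← h3]
      simp [evalData, Diagram.coeff, h1]
    have h0 : ((k + m + 2 : ℕ) * Fintype.card G) ^ a ≠ 0 := pow_ne_zero _ (by omega)
    rcases r' with _ | ⟨a', e'⟩
    · exact absurd h4 h0
    · refine ⟨_, rfl, ?_⟩
      by_cases h5 : e'.Admits (Sum.elim x z)
      · refine ⟨Nat.pow_right_injective hb ?_, h2 e' h5⟩
        simpa [evalData, Diagram.coeff, h5] using h4
      · simp [evalData, Diagram.coeff, h5] at h4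
  rcases r with _ | s
  · rcases r' with _ | s'
    · rfl
    · obtain ⟨s, hs, -⟩ := key _ _ (fun n x z => (h n x z).symm) s' rfl
      cases hs
  · obtain ⟨s', rfl, h1, g, h2, h3, h4⟩ := key _ _ h s rfl
    obtain ⟨s'', hs, -, g', -, -, h5⟩ := key _ _ (fun n x z => (h n x z).symm) s' rfl
    cases hs
    congr 1
    refine Prod.ext h1 ?_
    have := le_antisymm h4 h5
    rw [h3, h2, this]

/-- The composite may be computed from any compatible pair of representatives. -/
theorem starData_eq [Fintype G] {k l m : ℕ} {q : GPartition G l m} {p : GPartition G k l}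
    (hc : Compatible q p) :
    starData (Diagram.mk q.part q.label) (Diagram.mk p.part p.label) =
      some (alpha q.part p.part, Diagram.mk (star q.part p.part) (starLabel q p)) := by
  refine evalData_injective (fun n x z => ?_)
  rw [evalData_starData]
  exact sum_coeff_gp hc ℕ x z

/-- Left composition with a pair (exponent, diagram). -/
noncomputable def starLeft {k l m : ℕ} (c' : Diagram G l m) (r : Option (ℕ × Diagram G k l)) :
    Option (ℕ × Diagram G k m) :=
  r.bind fun s => (starData c' s.2).map fun s' => (s.1 + s'.1, s'.2)

/-- Right composition with a pair (exponent, diagram). -/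
noncomputable def starRight {k l m : ℕ} (r : Option (ℕ × Diagram G l m)) (c : Diagram G k l) :
    Option (ℕ × Diagram G k m) :=
  r.bind fun s => (starData s.2 c).map fun s' => (s.1 + s'.1, s'.2)

theorem evalData_shift [Fintype G] {k m n : ℕ} (a : ℕ) (r : Option (ℕ × Diagram G k m))
    (x : Fin k → Fin n × G) (z : Fin m → Fin n × G) :
    evalData ℕ (r.map fun s' => (a + s'.1, s'.2)) x z =
      (n * Fintype.card G) ^ a * evalData ℕ r x z := by
  rcases r with _ | ⟨b, e⟩
  · simp [evalData]
  · simp [evalData, pow_add, mul_assoc]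

theorem evalData_starLeft [Fintype G] {k l m n : ℕ} (c' : Diagram G l m)
    (r : Option (ℕ × Diagram G k l)) (x : Fin k → Fin n × G) (z : Fin m → Fin n × G) :
    evalData ℕ (starLeft c' r) x z =
      ∑ y : Fin l → Fin n × G, evalData ℕ r x y * c'.coeff ℕ y z := by
  rcases r with _ | ⟨b, e⟩
  · simp [evalData, starLeft]
  · simp only [starLeft, Option.bind_some, evalData_shift, evalData_starData, Finset.mul_sum]
    simp [evalData, mul_assoc]

theorem evalData_starRight [Fintype G] {k l m n : ℕ} (r : Option (ℕ × Diagram G l m))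
    (c : Diagram G k l) (x : Fin k → Fin n × G) (z : Fin m → Fin n × G) :
    evalData ℕ (starRight r c) x z =
      ∑ y : Fin l → Fin n × G, c.coeff ℕ x y * evalData ℕ r y z := by
  rcases r with _ | ⟨b, e⟩
  · simp [evalData, starRight]
  · simp only [starRight, Option.bind_some, evalData_shift, evalData_starData, Finset.mul_sum]
    simp [evalData, mul_left_comm]

theorem star_assoc [Fintype G] {k l m o : ℕ} (c₃ : Diagram G m o) (c₂ : Diagram G l m)
    (c₁ : Diagram G k l) :
    starRight (starData c₃ c₂) c₁ = starLeft c₃ (starData c₂ c₁) := by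
  refine evalData_injective (fun n x z => ?_)
  simp only [evalData_starLeft, evalData_starRight, evalData_starData, Finset.mul_sum,
    Finset.sum_mul, mul_assoc]
  exact Finset.sum_comm

/-- The identity diagram: the parts are `{i, i'}`, all labels are `1`. -/
def Diagram.one (G : Type v) [Group G] (k : ℕ) : Diagram G k k :=
  Diagram.mk (Setoid.ker (Sum.elim id id)) (fun _ => 1)

theorem Diagram.coeff_one (R : Type u) [Zero R] [One R] {k n : ℕ} (x y : Fin k → Fin n × G) :
    (Diagram.one G k).coeff R x y = if x = y then 1 else 0 := by
  unfold Diagram.coeff Diagram.one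
  simp only [Diagram.mk_admits, GPartition.Admits]
  congr 1
  simp only [eq_iff_iff]
  constructor
  · intro h
    funext i
    have := h (Sum.inl i) (Sum.inr i) (by simp [Setoid.ker_def])
    simpa [Prod.ext_iff] using this
  · rintro rfl a b hab
    have : (Sum.elim x x : Vertex k k → Fin n × G) = x ∘ (Sum.elim id id) := by
      funext a
      rcases a with a | a <;> rfl
    have hab' : (Sum.elim id id : Vertex k k → Fin k) a = Sum.elim id id b := hab
    simp only [this, Function.comp_apply, hab', and_self]

theorem starData_one [Fintype G] {k l : ℕ} (c : Diagram G k l) :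
    starData c (Diagram.one G k) = some (0, c) := by
  refine evalData_injective (fun n x z => ?_)
  rw [evalData_starData]
  simp [Diagram.coeff_one, evalData]

theorem one_starData [Fintype G] {k l : ℕ} (c : Diagram G k l) :
    starData (Diagram.one G l) c = some (0, c) := by
  refine evalData_injective (fun n x z => ?_)
  rw [evalData_starData]
  simp [Diagram.coeff_one, evalData]

end Diagrams

/-! ### The group partition category -/

/-- `G`-partition categories: the objects of `Par(G, d)` are the natural numbers. -/
structure Par (𝕜 : Type u) [CommRing 𝕜] (G : Type v) [Group G] (d : 𝕜) : Type where
  /-- the object `k` of `Par(G, d)` -/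
  ob ::
  /-- the natural number underlying an object -/
  num : ℕ

section Category

variable {𝕜 : Type u} [CommRing 𝕜] {G : Type v} [Group G]

/-- `[Q, h] ∘ [P, g] = d ^ α(Q, P) [Q ⋆ P, h ⋆ g]` for a compatible pair, and `0` otherwise. -/
noncomputable def compDiagram (d : 𝕜) {k l m : ℕ} (c' : Diagram G l m) (c : Diagram G k l) :
    Diagram G k m →₀ 𝕜 :=
  match starData c' c with
  | none => 0
  | some (a, e) => Finsupp.single e (d ^ a)

/-- Bilinear extension of the composition of diagrams (first argument applied first). -/
noncomputable def compLin (d : 𝕜) (k l m : ℕ) :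
    (Diagram G k l →₀ 𝕜) →ₗ[𝕜] (Diagram G l m →₀ 𝕜) →ₗ[𝕜] (Diagram G k m →₀ 𝕜) :=
  Finsupp.lift _ 𝕜 _ fun c => Finsupp.lift _ 𝕜 _ fun c' => compDiagram d c' c

theorem compLin_single (d : 𝕜) {k l m : ℕ} (c : Diagram G k l) (c' : Diagram G l m) (a b : 𝕜) :
    compLin d k l m (Finsupp.single c a) (Finsupp.single c' b) =
      (a * b) • compDiagram d c' c := by
  simp [compLin, mul_smul]

theorem compLin_one [Fintype G] (d : 𝕜) {k l : ℕ} (f : Diagram G k l →₀ 𝕜) :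
    compLin d k l l f (Finsupp.single (Diagram.one G l) 1) = f := by
  induction f using Finsupp.induction_linear with
  | zero => simp
  | add f g hf hg => simp [hf, hg]
  | single c a => simp [compLin_single, compDiagram, one_starData]

theorem one_compLin [Fintype G] (d : 𝕜) {k l : ℕ} (f : Diagram G k l →₀ 𝕜) :
    compLin d k k l (Finsupp.single (Diagram.one G k) 1) f = f := by
  induction f using Finsupp.induction_linear with
  | zero => simp
  | add f g hf hg => simp [hf, hg]
  | single c a => simp [compLin_single, compDiagram, starData_one]

theorem compLin_assoc [Fintype G] (d : 𝕜) {k l m o : ℕ} (f : Diagram G k l →₀ 𝕜)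
    (g : Diagram G l m →₀ 𝕜) (h : Diagram G m o →₀ 𝕜) :
    compLin d k m o (compLin d k l m f g) h = compLin d k l o f (compLin d l m o g h) := by
  induction f using Finsupp.induction_linear with
  | zero => simp
  | add f g hf hg => simp [hf, hg]
  | single c a =>
  induction g using Finsupp.induction_linear with
  | zero => simp
  | add f g hf hg => simp [hf, hg]
  | single c' b =>
  induction h using Finsupp.induction_linear with
  | zero => simp
  | add f g hf hg => simp [hf, hg]
  | single c'' e =>
  let ev : Option (ℕ × Diagram G k o) → (Diagram G k o →₀ 𝕜) := fun r =>
    match r with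
    | none => 0
    | some (a, e) => Finsupp.single e (d ^ a)
  have h1 : compLin d k m o (compDiagram d c' c) (Finsupp.single c'' 1) =
      ev (starLeft c'' (starData c' c)) := by
    unfold compDiagram starLeft
    rcases starData c' c with _ | ⟨a, s⟩
    · simp [ev]
    · simp only [compLin_single, Option.bind_some, compDiagram]
      rcases starData c'' s with _ | ⟨a', s'⟩
      · simp [ev]
      · simp [ev, pow_add]
  have h2 : compLin d k l o (Finsupp.single c 1) (compDiagram d c'' c') =
      ev (starRight (starData c'' c') c) := by
    unfold compDiagram starRight
    rcases starData c'' c' with _ | ⟨a, s⟩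
    · simp [ev]
    · simp only [compLin_single, Option.bind_some, compDiagram]
      rcases starData s c with _ | ⟨a', s'⟩
      · simp [ev]
      · simp [ev, pow_add]
  have h3 : (Finsupp.single c'' e : Diagram G m o →₀ 𝕜) = e • Finsupp.single c'' 1 := by simp
  have h4 : (Finsupp.single c a : Diagram G k l →₀ 𝕜) = a • Finsupp.single c 1 := by simp
  rw [compLin_single d c c', compLin_single d c' c'', h3, h4]
  simp only [map_smul, LinearMap.smul_apply]
  rw [h1, h2, star_assoc]
  simp only [smul_smul]
  congr 1
  ring

/-- The category `Par(G, d)`: morphisms are linear combinations of `G`-partition diagrams. -/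
noncomputable instance parCategory [Fintype G] (d : 𝕜) : Category (Par 𝕜 G d) where
  Hom X Y := Diagram G X.num Y.num →₀ 𝕜
  id X := Finsupp.single (Diagram.one G X.num) 1
  comp f g := compLin d _ _ _ f g
  id_comp f := one_compLin d f
  comp_id f := compLin_one d f
  assoc f g h := compLin_assoc d f g h

noncomputable instance parPreadditive [Fintype G] (d : 𝕜) : Preadditive (Par 𝕜 G d) where
  homGroup X Y := inferInstanceAs (AddCommGroup (Diagram G X.num Y.num →₀ 𝕜))
  add_comp X Y Z f f' g := by
    change compLin d _ _ _ (_ + _) _ = compLin d _ _ _ _ _ + compLin d _ _ _ _ _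
    simp
  comp_add X Y Z f g g' := by
    change compLin d _ _ _ _ (_ + _) = compLin d _ _ _ _ _ + compLin d _ _ _ _ _
    simp

noncomputable instance parLinear [Fintype G] (d : 𝕜) : Linear 𝕜 (Par 𝕜 G d) where
  homModule X Y := inferInstanceAs (Module 𝕜 (Diagram G X.num Y.num →₀ 𝕜))
  smul_comp X Y Z r f g := by
    exact LinearMap.map_smul₂ (compLin d X.num Y.num Z.num) r f g
  comp_smul X Y Z f r g := by
    exact (compLin d X.num Y.num Z.num f).map_smul r g

end Category

/-! ### Wreath products and their permutation representations -/

/-- The wreath product `G_n = Gⁿ ⋊ 𝔖_n`, where `(π · g)_i = g_{π⁻¹(i)}`. -/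
abbrev Wreath (G : Type v) [Group G] (n : ℕ) : Type v :=
  (Fin n → G) ⋊[mulAutArrow] Equiv.Perm (Fin n)

section Action

open PiTensorProduct TensorProduct

variable (𝕜 : Type u) [CommRing 𝕜] (G : Type v) [Group G] (n : ℕ)

/-- The module `V = Aⁿ`, where `A = 𝕜G` is the group algebra. -/
abbrev PermModule : Type (max u v) := Fin n → MonoidAlgebra 𝕜 G

/-- The permutation representation of `G_n` on `V = Aⁿ`: `(gπ · a)_i = g_i a_{π⁻¹(i)}`. -/
noncomputable def permRep : Representation 𝕜 (Wreath G n) (PermModule 𝕜 G n) where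
  toFun γ :=
    { toFun := fun a i => MonoidAlgebra.single (γ.left i) 1 * a (γ.right⁻¹ i)
      map_add' := fun a b => by funext i; simp [mul_add]
      map_smul' := fun r a => by funext i; simp }
  map_one' := by
    refine LinearMap.ext fun a => funext fun i => ?_
    simp [← MonoidAlgebra.one_def]
  map_mul' γ δ := by
    refine LinearMap.ext fun a => funext fun i => ?_
    simp only [SemidirectProduct.mul_left, SemidirectProduct.mul_right, mul_inv_rev,
      LinearMap.coe_mk, AddHom.coe_mk, Module.End.mul_apply, Pi.mul_apply,
      Equiv.Perm.coe_mul, Function.comp_apply, ← mul_assoc, MonoidAlgebra.single_mul_single,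
      mul_one]
    rfl

/-- The tensor power `V^{⊗k}` with the diagonal action of `G_n`. -/
noncomputable def tensorRep (k : ℕ) :
    Representation 𝕜 (Wreath G n) (⨂[𝕜] _ : Fin k, PermModule 𝕜 G n) where
  toFun γ := PiTensorProduct.map fun _ => permRep 𝕜 G n γ
  map_one' := by
    simp only [map_one]
    exact PiTensorProduct.map_one
  map_mul' γ δ := by
    simp only [map_mul]
    exact PiTensorProduct.map_mul _ _

variable {G n}

/-- The element `g e_i` of `V`, for `s = (i, g)`. -/
noncomputable def vec (s : Fin n × G) : PermModule 𝕜 G n :=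
  Pi.single s.1 (MonoidAlgebra.single s.2 1)

variable (G n) in
/-- The basis of `V` consisting of all `g e_i`. -/
noncomputable def vecBasis : Module.Basis (Fin n × G) 𝕜 (PermModule 𝕜 G n) :=
  (Pi.basis fun _ => MonoidAlgebra.basis G 𝕜).reindex (Equiv.sigmaEquivProd (Fin n) G)

theorem vecBasis_apply (s : Fin n × G) : vecBasis 𝕜 G n s = vec 𝕜 s := by
  simp [vecBasis, vec]

/-- The tensor product of the vectors `h_a e_{i_a}`, where `x a = (i_a, h_a)`. The tensor factors
of `V^{⊗k}` and the vertices of a row of a diagram are indexed by the same set `Fin k`. -/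
noncomputable def tensorVec {k : ℕ} (x : Fin k → Fin n × G) : ⨂[𝕜] _ : Fin k, PermModule 𝕜 G n :=
  ⨂ₜ[𝕜] a, vec 𝕜 (x a)

variable (G n) in
/-- The basis of `V^{⊗k}` consisting of tensor products of the `g e_i`. -/
noncomputable def tensorBasis (k : ℕ) :
    Module.Basis (Fin k → Fin n × G) 𝕜 (⨂[𝕜] _ : Fin k, PermModule 𝕜 G n) :=
  Basis.piTensorProduct fun _ => vecBasis 𝕜 G n

theorem tensorBasis_apply {k : ℕ} (x : Fin k → Fin n × G) :
    tensorBasis 𝕜 G n k x = tensorVec 𝕜 x := by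
  simp [tensorBasis, tensorVec, vecBasis_apply]

theorem permRep_vec (γ : Wreath G n) (s : Fin n × G) :
    permRep 𝕜 G n γ (vec 𝕜 s) = vec 𝕜 (γ.right s.1, γ.left (γ.right s.1) * s.2) := by
  funext i
  simp only [permRep, vec, MonoidHom.coe_mk, OneHom.coe_mk, LinearMap.coe_mk, AddHom.coe_mk]
  by_cases h : i = γ.right s.1
  · subst h
    simp [MonoidAlgebra.single_mul_single]
  · have h' : γ.right⁻¹ i ≠ s.1 := by
      intro h2
      apply h
      rw [← h2]
      simp
    rw [Pi.single_eq_of_ne h, Pi.single_eq_of_ne h', mul_zero]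

/-- The action of `G_n` on the index set of the basis of `V`. -/
def actIndex (γ : Wreath G n) : (Fin n × G) ≃ (Fin n × G) where
  toFun s := (γ.right s.1, γ.left (γ.right s.1) * s.2)
  invFun s := (γ.right⁻¹ s.1, (γ.left s.1)⁻¹ * s.2)
  left_inv s := by simp
  right_inv s := by simp

theorem tensorRep_tensorVec {k : ℕ} (γ : Wreath G n) (x : Fin k → Fin n × G) :
    tensorRep 𝕜 G n k γ (tensorVec 𝕜 x) = tensorVec 𝕜 (fun a => actIndex γ (x a)) := by
  simp only [tensorRep, tensorVec, MonoidHom.coe_mk, OneHom.coe_mk, PiTensorProduct.map_tprod,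
    permRep_vec]
  rfl

theorem Diagram.admits_act {k l : ℕ} (c : Diagram G k l) (γ : Wreath G n)
    (x : Vertex k l → Fin n × G) :
    c.Admits (fun a => actIndex γ (x a)) ↔ c.Admits x := by
  induction c using Diagram.ind with | h P g => ?_
  simp only [Diagram.mk_admits, GPartition.Admits]
  refine forall₃_congr fun a b _ => ?_
  simp only [actIndex, Equiv.coe_fn_mk, EmbeddingLike.apply_eq_iff_eq]
  refine and_congr_right fun h => ?_
  rw [h, mul_assoc, mul_assoc, mul_right_inj]

theorem Diagram.coeff_act {k l : ℕ} (c : Diagram G k l) (γ : Wreath G n)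
    (x : Fin k → Fin n × G) (y : Fin l → Fin n × G) :
    c.coeff 𝕜 (fun a => actIndex γ (x a)) (fun a => actIndex γ (y a)) = c.coeff 𝕜 x y := by
  unfold Diagram.coeff
  refine if_congr ?_ rfl rfl
  rw [← c.admits_act γ (Sum.elim x y)]
  have : (Sum.elim (fun a => actIndex γ (x a)) (fun a => actIndex γ (y a)) : Vertex k l → _) =
      fun a => actIndex γ (Sum.elim x y a) := by
    funext a
    rcases a with a | a <;> rfl
  rw [this]

theorem rep_hom_ext {k : ℕ} {X : Rep.{max u v} 𝕜 (Wreath G n)}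
    {f g : Rep.of (tensorRep 𝕜 G n k) ⟶ X}
    (h : ∀ x, f.hom (tensorVec 𝕜 x) = g.hom (tensorVec 𝕜 x)) : f = g := by
  refine Rep.hom_ext (Representation.IntertwiningMap.ext ?_)
  refine (tensorBasis 𝕜 G n k).ext fun x => ?_
  rw [tensorBasis_apply]
  exact h x

variable [Fintype G]

variable (n) in
/-- The linear map `V^{⊗k} → V^{⊗l}` attached to a `G`-partition diagram, through its matrix
coefficients. The values on the generating diagrams and the compatibility with tensor products,
which determine the action functor, are `diagramMap_merge`, `diagramMap_split`,
`diagramMap_crossing`, `diagramMap_bottomPin`, `diagramMap_topPin`, `diagramMap_token` and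
`diagramMap_tensor` below. -/
noncomputable def diagramMap {k l : ℕ} (c : Diagram G k l) :
    (⨂[𝕜] _ : Fin k, PermModule 𝕜 G n) →ₗ[𝕜] (⨂[𝕜] _ : Fin l, PermModule 𝕜 G n) :=
  (tensorBasis 𝕜 G n k).constr 𝕜 fun x =>
    ∑ y : Fin l → Fin n × G, c.coeff 𝕜 x y • tensorVec 𝕜 y

theorem diagramMap_tensorVec {k l : ℕ} (c : Diagram G k l) (x : Fin k → Fin n × G) :
    diagramMap 𝕜 n c (tensorVec 𝕜 x) =
      ∑ y : Fin l → Fin n × G, c.coeff 𝕜 x y • tensorVec 𝕜 y := by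
  rw [← tensorBasis_apply, diagramMap, Module.Basis.constr_basis]

theorem diagramMap_equivariant {k l : ℕ} (c : Diagram G k l) (γ : Wreath G n) :
    diagramMap 𝕜 n c ∘ₗ tensorRep 𝕜 G n k γ = tensorRep 𝕜 G n l γ ∘ₗ diagramMap 𝕜 n c := by
  refine (tensorBasis 𝕜 G n k).ext fun x => ?_
  simp only [LinearMap.comp_apply, tensorBasis_apply, tensorRep_tensorVec, diagramMap_tensorVec,
    map_sum, map_smul]
  symm
  refine Fintype.sum_equiv (Equiv.piCongrRight fun _ => actIndex γ) _ _ fun y => ?_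
  rw [← c.coeff_act 𝕜 γ x y]
  rfl

variable (n) in
/-- The equivariant linear map attached to a `G`-partition diagram. -/
noncomputable def diagramHom {k l : ℕ} (c : Diagram G k l) :
    Rep.of (tensorRep 𝕜 G n k) ⟶ Rep.of (tensorRep 𝕜 G n l) :=
  Rep.ofHom ⟨diagramMap 𝕜 n c, diagramMap_equivariant 𝕜 c⟩

variable (n) in
/-- Linear extension of `diagramHom`. -/
noncomputable def actionMap (k l : ℕ) : (Diagram G k l →₀ 𝕜) →ₗ[𝕜]
    (Rep.of (tensorRep 𝕜 G n k) ⟶ Rep.of (tensorRep 𝕜 G n l)) :=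
  Finsupp.lift _ 𝕜 _ fun c => diagramHom 𝕜 n c

theorem actionMap_one (k : ℕ) :
    actionMap 𝕜 n k k (Finsupp.single (Diagram.one G k) 1) = 𝟙 _ := by
  refine rep_hom_ext 𝕜 fun x => ?_
  have : actionMap 𝕜 n k k (Finsupp.single (Diagram.one G k) 1) =
      diagramHom 𝕜 n (Diagram.one G k) := by simp [actionMap]
  rw [this]
  refine (diagramMap_tensorVec 𝕜 _ x).trans ?_
  simp [Diagram.coeff_one]

theorem actionMap_compDiagram {k l m : ℕ} (c : Diagram G k l) (c' : Diagram G l m) :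
    actionMap 𝕜 n k m (compDiagram ((n : 𝕜) * Fintype.card G) c' c) =
      diagramHom 𝕜 n c ≫ diagramHom 𝕜 n c' := by
  refine rep_hom_ext 𝕜 fun x => ?_
  have h1 : (actionMap 𝕜 n k m (compDiagram ((n : 𝕜) * Fintype.card G) c' c)).hom
      (tensorVec 𝕜 x) = ∑ z, evalData 𝕜 (starData c' c) x z • tensorVec 𝕜 z := by
    unfold compDiagram
    rcases starData c' c with _ | ⟨a, e⟩
    · simp [evalData]
    · have : actionMap 𝕜 n k m (Finsupp.single e (((n : 𝕜) * Fintype.card G) ^ a)) =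
        (((n : 𝕜) * Fintype.card G) ^ a) • diagramHom 𝕜 n e := by simp [actionMap]
      simp only [this]
      change (((n : 𝕜) * Fintype.card G) ^ a) • diagramMap 𝕜 n e (tensorVec 𝕜 x) = _
      rw [diagramMap_tensorVec]
      simp [evalData, Finset.smul_sum, mul_smul]
  have h2 : (diagramHom 𝕜 n c ≫ diagramHom 𝕜 n c').hom (tensorVec 𝕜 x) =
      diagramMap 𝕜 n c' (diagramMap 𝕜 n c (tensorVec 𝕜 x)) := rfl
  rw [h1, h2]
  simp only [diagramMap_tensorVec, map_sum, map_smul, evalData_starData, Finset.sum_smul,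
    Finset.smul_sum, smul_smul]
  exact Finset.sum_comm

theorem actionMap_comp {k l m : ℕ} (f : Diagram G k l →₀ 𝕜) (g : Diagram G l m →₀ 𝕜) :
    actionMap 𝕜 n k m (compLin ((n : 𝕜) * Fintype.card G) k l m f g) =
      actionMap 𝕜 n k l f ≫ actionMap 𝕜 n l m g := by
  induction f using Finsupp.induction_linear with
  | zero => simp
  | add f g hf hg => simp [hf, hg]
  | single c a =>
  induction g using Finsupp.induction_linear with
  | zero => simp
  | add f g hf hg => simp [hf, hg]
  | single c' b =>
  rw [compLin_single, map_smul, actionMap_compDiagram]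
  simp [actionMap, smul_smul, mul_comm]

variable (G n) in
/-- The action functor `Φ_n : Par(G, n|G|) ⥤ A_n-mod`, with `k ↦ V^{⊗k}`. -/
noncomputable def actionFunctor :
    Par 𝕜 G ((n : 𝕜) * Fintype.card G) ⥤ Rep.{max u v} 𝕜 (Wreath G n) where
  obj X := Rep.of (tensorRep 𝕜 G n X.num)
  map f := actionMap 𝕜 n _ _ f
  map_id X := actionMap_one 𝕜 X.num
  map_comp f g := actionMap_comp 𝕜 f g

instance actionFunctor_additive : (actionFunctor 𝕜 G n).Additive where
  map_add {_ _ f g} := map_add (actionMap 𝕜 n _ _) f g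

instance actionFunctor_linear : (actionFunctor 𝕜 G n).Linear 𝕜 where
  map_smul f r := map_smul (actionMap 𝕜 n _ _) r f

end Action

/-! ### Generating diagrams and tensor products of diagrams -/

section Generators

variable {G : Type v} [Group G] {n : ℕ}

/-- The diagram with a single part and trivial labels: the merge `2 → 1`, the split `1 → 2`, and
the pins `0 → 1` and `1 → 0` are of this form. -/
def Diagram.single (G : Type v) [Group G] (k l : ℕ) : Diagram G k l := Diagram.mk ⊤ fun _ => 1

/-- The crossing `2 → 2`. -/
def Diagram.crossing (G : Type v) [Group G] : Diagram G 2 2 :=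
  Diagram.mk (Setoid.ker (Sum.elim id (Equiv.swap 0 1))) fun _ => 1

/-- The token labelled `g`. -/
def Diagram.token (g : G) : Diagram G 1 1 := Diagram.mk ⊤ (Sum.elim (fun _ => g) fun _ => 1)

theorem Diagram.single_admits {k l : ℕ} (x : Vertex k l → Fin n × G) :
    (Diagram.single G k l).Admits x ↔ ∀ a b, x a = x b := by
  simp [Diagram.single, Diagram.mk_admits, GPartition.Admits, Prod.ext_iff]

/-- Split the vertices of a juxtaposed diagram into those of its two halves. -/
def juxta {k l k' l' : ℕ} : Vertex (k + k') (l + l') ≃ Vertex k l ⊕ Vertex k' l' :=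
  (Equiv.sumCongr finSumFinEquiv.symm finSumFinEquiv.symm).trans (Equiv.sumSumSumComm _ _ _ _)

/-- The juxtaposition of two partitions. -/
def juxtaPart {k l k' l' : ℕ} (P : Setoid (Vertex k l)) (P' : Setoid (Vertex k' l')) :
    Setoid (Vertex (k + k') (l + l')) where
  r a b := Sum.LiftRel P P' (juxta a) (juxta b)
  iseqv := by
    refine ⟨fun a => ?_, fun {a b} h => ?_, fun {a b c} h h' => ?_⟩
    · rcases juxta a with a | a
      · exact Sum.LiftRel.inl (P.refl _)
      · exact Sum.LiftRel.inr (P'.refl _)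
    · revert h
      rcases juxta a with a | a <;> rcases juxta b with b | b <;> intro h <;> cases h
      · exact Sum.LiftRel.inl (P.symm ‹_›)
      · exact Sum.LiftRel.inr (P'.symm ‹_›)
    · revert h h'
      rcases juxta a with a | a <;> rcases juxta b with b | b <;> rcases juxta c with c | c <;>
        intro h h' <;> cases h <;> cases h'
      · exact Sum.LiftRel.inl (P.trans ‹_› ‹_›)
      · exact Sum.LiftRel.inr (P'.trans ‹_› ‹_›)

/-- The tensor product of two diagrams: horizontal juxtaposition. -/
def Diagram.tensor {k l k' l' : ℕ} (c : Diagram G k l) (c' : Diagram G k' l') :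
    Diagram G (k + k') (l + l') :=
  Quotient.lift₂ (fun (p : GPartition G k l) (p' : GPartition G k' l') =>
    Diagram.mk (juxtaPart p.part p'.part) (Sum.elim p.label p'.label ∘ juxta)) (by
      rintro ⟨P, g⟩ ⟨P', g'⟩ ⟨Q, h⟩ ⟨Q', h'⟩ ⟨h1, t, ht⟩ ⟨h1', t', ht'⟩
      dsimp only at h1 h1' t t' ht ht'
      subst h1 h1'
      refine Diagram.mk_eq_mk.2 ⟨rfl, Quotient.lift (fun a => Sum.elim
        (fun v => t (Quotient.mk _ v)) (fun v => t' (Quotient.mk _ v)) (juxta a)) ?_, ?_⟩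
      · intro a b hab
        have hab' : Sum.LiftRel P P' (juxta a) (juxta b) := hab
        revert hab'
        rcases juxta a with a | a <;> rcases juxta b with b | b <;> intro h <;> cases h
        · exact congrArg t (Quotient.sound ‹_›)
        · exact congrArg t' (Quotient.sound ‹_›)
      · intro a
        simp only [Function.comp_apply, Quotient.lift_mk]
        rcases juxta a with a | a
        · exact ht a
        · exact ht' a) c c'

theorem Diagram.tensor_admits {k l k' l' : ℕ} (c : Diagram G k l) (c' : Diagram G k' l')
    (x : Vertex k l → Fin n × G) (x' : Vertex k' l' → Fin n × G) :
    (c.tensor c').Admits (Sum.elim x x' ∘ juxta) ↔ c.Admits x ∧ c'.Admits x' := by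
  induction c using Diagram.ind with | h P g => ?_
  induction c' using Diagram.ind with | h P' g' => ?_
  change GPartition.Admits ⟨juxtaPart P P', _⟩ _ ↔ GPartition.Admits _ _ ∧ GPartition.Admits _ _
  constructor
  · intro h
    refine ⟨fun a b hab => ?_, fun a b hab => ?_⟩
    · have := h (juxta.symm (Sum.inl a)) (juxta.symm (Sum.inl b))
        (show Sum.LiftRel P P' _ _ by simpa using hab)
      simpa using this
    · have := h (juxta.symm (Sum.inr a)) (juxta.symm (Sum.inr b))
        (show Sum.LiftRel P P' _ _ by simpa using hab)
      simpa using this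
  · rintro ⟨h, h'⟩ a b hab
    have hab' : Sum.LiftRel P P' (juxta a) (juxta b) := hab
    simp only [Function.comp_apply]
    revert hab'
    rcases juxta a with a | a <;> rcases juxta b with b | b <;> intro h <;> cases h
    · exact h a b ‹_›
    · exact h' a b ‹_›

end Generators

/-! ### The action functor on generators and on tensor products -/

section Values

open PiTensorProduct TensorProduct

variable (𝕜 : Type u) [CommRing 𝕜] {G : Type v} [Group G] [Fintype G] {n : ℕ}

theorem diagramMap_eq {k l : ℕ} (c : Diagram G k l) (x : Fin k → Fin n × G)
    (y₀ : Fin l → Fin n × G) (h : ∀ y, c.Admits (Sum.elim x y) ↔ y = y₀) :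
    diagramMap 𝕜 n c (tensorVec 𝕜 x) = tensorVec 𝕜 y₀ := by
  rw [diagramMap_tensorVec, Finset.sum_eq_single y₀]
  · rw [Diagram.coeff, if_pos ((h y₀).2 rfl), one_smul]
  · intro y _ hy
    rw [Diagram.coeff, if_neg (fun h' => hy ((h y).1 h')), zero_smul]
  · simp

/-- Merge: `g e_i ⊗ h e_j ↦ δ_{g,h} δ_{i,j} g e_i`. -/
theorem diagramMap_merge (x : Fin 2 → Fin n × G) :
    diagramMap 𝕜 n (Diagram.single G 2 1) (tensorVec 𝕜 x) =
      if x 0 = x 1 then tensorVec 𝕜 (fun _ => x 0) else 0 := by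
  split_ifs with h
  · refine diagramMap_eq 𝕜 _ _ _ fun y => ?_
    rw [Diagram.single_admits]
    simp [Fin.forall_fin_two, h, funext_iff]
    grind
  · rw [diagramMap_tensorVec]
    refine Finset.sum_eq_zero fun y _ => ?_
    rw [Diagram.coeff, if_neg, zero_smul]
    intro h'
    exact h ((Diagram.single_admits _).1 h' (Sum.inl 0) (Sum.inl 1))

/-- Split: `g e_i ↦ g e_i ⊗ g e_i`. -/
theorem diagramMap_split (x : Fin 1 → Fin n × G) :
    diagramMap 𝕜 n (Diagram.single G 1 2) (tensorVec 𝕜 x) = tensorVec 𝕜 (fun _ => x 0) := by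
  refine diagramMap_eq 𝕜 _ _ _ fun y => ?_
  rw [Diagram.single_admits]
  simp [Fin.forall_fin_two, funext_iff]
  grind

/-- Bottom pin: `1 ↦ ∑ g e_i`. -/
theorem diagramMap_bottomPin (x : Fin 0 → Fin n × G) :
    diagramMap 𝕜 n (Diagram.single G 0 1) (tensorVec 𝕜 x) =
      ∑ s : Fin n × G, tensorVec 𝕜 (fun _ => s) := by
  rw [diagramMap_tensorVec]
  refine Fintype.sum_equiv (Equiv.funUnique (Fin 1) (Fin n × G)) _ _ fun y => ?_
  rw [Diagram.coeff, if_pos, one_smul]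
  · congr 1
    funext a
    rw [Subsingleton.elim a 0]
    rfl
  · rw [Diagram.single_admits]
    simp

/-- Top pin: `g e_i ↦ 1`. -/
theorem diagramMap_topPin (x : Fin 1 → Fin n × G) :
    diagramMap 𝕜 n (Diagram.single G 1 0) (tensorVec 𝕜 x) = tensorVec 𝕜 Fin.elim0 := by
  refine diagramMap_eq 𝕜 _ _ _ fun y => ?_
  rw [Diagram.single_admits]
  simp [Subsingleton.elim y Fin.elim0]

/-- Crossing: `v ⊗ w ↦ w ⊗ v`. -/
theorem diagramMap_crossing (x : Fin 2 → Fin n × G) :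
    diagramMap 𝕜 n (Diagram.crossing G) (tensorVec 𝕜 x) =
      tensorVec 𝕜 (fun a => x (Equiv.swap 0 1 a)) := by
  refine diagramMap_eq 𝕜 _ _ _ fun y => ?_
  simp [Diagram.crossing, Diagram.mk_admits, GPartition.Admits, Setoid.ker_def,
    Fin.forall_fin_two, funext_iff, Prod.ext_iff]
  grind

/-- Token: `h e_i ↦ h g⁻¹ e_i`. -/
theorem diagramMap_token (g : G) (x : Fin 1 → Fin n × G) :
    diagramMap 𝕜 n (Diagram.token g) (tensorVec 𝕜 x) =
      tensorVec 𝕜 (fun _ => ((x 0).1, (x 0).2 * g⁻¹)) := by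
  refine diagramMap_eq 𝕜 _ _ _ fun y => ?_
  simp [Diagram.token, Diagram.mk_admits, GPartition.Admits, funext_iff, Prod.ext_iff]
  grind

/-- `Φ_n` sends juxtaposition to the tensor product of linear maps, under the isomorphism
`V^{⊗k} ⊗ V^{⊗k'} ≅ V^{⊗(k+k')}`. -/
theorem diagramMap_tensor {k l k' l' : ℕ} (c : Diagram G k l) (c' : Diagram G k' l')
    (v : ⨂[𝕜] _ : Fin k, PermModule 𝕜 G n) (v' : ⨂[𝕜] _ : Fin k', PermModule 𝕜 G n) :
    diagramMap 𝕜 n (c.tensor c') (TensorPower.mulEquiv (v ⊗ₜ[𝕜] v')) =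
      TensorPower.mulEquiv (diagramMap 𝕜 n c v ⊗ₜ[𝕜] diagramMap 𝕜 n c' v') := by
  have hmul : ∀ {k k' : ℕ} (x : Fin k → Fin n × G) (x' : Fin k' → Fin n × G),
      TensorPower.mulEquiv (R := 𝕜) (M := PermModule 𝕜 G n) (tensorVec 𝕜 x ⊗ₜ[𝕜] tensorVec 𝕜 x') =
        tensorVec 𝕜 (Fin.append x x') := by
    intro k k' x x'
    have := TensorPower.tprod_mul_tprod 𝕜 (fun a => vec 𝕜 (x a)) (fun a => vec 𝕜 (x' a))
    rw [TensorPower.gMul_def] at this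
    refine this.trans ?_
    unfold tensorVec
    congr 1
    funext a
    refine Fin.addCases (fun a => ?_) (fun a => ?_) a <;> simp
  have key : (diagramMap 𝕜 n (c.tensor c') ∘ₗ
      (TensorPower.mulEquiv (R := 𝕜) (M := PermModule 𝕜 G n) (n := k) (m := k')).toLinearMap) =
      (TensorPower.mulEquiv (R := 𝕜) (M := PermModule 𝕜 G n) (n := l) (m := l')).toLinearMap ∘ₗ
        TensorProduct.map (diagramMap 𝕜 n c) (diagramMap 𝕜 n c') := by
    refine ((tensorBasis 𝕜 G n k).tensorProduct (tensorBasis 𝕜 G n k')).ext fun ⟨x, x'⟩ => ?_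
    simp only [Module.Basis.tensorProduct_apply, tensorBasis_apply, LinearMap.comp_apply,
      LinearEquiv.coe_coe, TensorProduct.map_tmul, hmul, diagramMap_tensorVec,
      TensorProduct.sum_tmul, TensorProduct.tmul_sum, map_sum, TensorProduct.smul_tmul_smul,
      map_smul]
    rw [← Fintype.sum_prod_type']
    symm
    refine Fintype.sum_equiv ((Equiv.prodComm _ _).trans (Fin.appendEquiv l l')) _ _ fun y => ?_
    have h1 : (Sum.elim (Fin.append x x') (Fin.append y.2 y.1) : Vertex (k + k') (l + l') → _) =
        Sum.elim (Sum.elim x y.2) (Sum.elim x' y.1) ∘ juxta := by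
      funext a
      rcases a with a | a <;> refine Fin.addCases (fun a => ?_) (fun a => ?_) a <;>
        simp [juxta]
    have h2 : (c.tensor c').coeff 𝕜 (Fin.append x x') (Fin.append y.2 y.1) =
        c.coeff 𝕜 x y.2 * c'.coeff 𝕜 x' y.1 := by
      simp only [Diagram.coeff, h1, Diagram.tensor_admits]
      by_cases ha : c.Admits (Sum.elim x y.2) <;> by_cases hb : c'.Admits (Sum.elim x' y.1) <;>
        simp [ha, hb]
    change _ = (c.tensor c').coeff 𝕜 (Fin.append x x') (Fin.append y.2 y.1) •
      tensorVec 𝕜 (Fin.append y.2 y.1)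
    rw [h2]
  exact LinearMap.congr_fun key (v ⊗ₜ[𝕜] v')

end Values

/-- The element `x_{[P, g]}`, as a morphism of `Par(G, d)`. -/
noncomputable def xMor {𝕜 : Type u} [CommRing 𝕜] {G : Type v} [Group G] [Fintype G] (d : 𝕜)
    {k l : ℕ} (c : Diagram G k l) : (Par.ob k : Par 𝕜 G d) ⟶ Par.ob l :=
  xElem 𝕜 c

end GroupPartition

/-! A pair of basis tensors of $V^{\otimes k}$ and $V^{\otimes l}$ is a state $w$, placing a basis
vector $h_ae_{i_a}$ at each of the $k+l$ vertices. Every state has a type `Diagram.ofState w`: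
vertices with equal index form a part, and the group components are the labels. Two facts about
types carry the proof.

First, the matrix coefficient of a diagram $c$ at $w$ is $1$ exactly when $c$ equals or is strictly
finer than the type of $w$ (`Diagram.admits_iff_eq_or_strictlyFiner`). The recursion for $x_c$ is
Möbius inversion for this relation, so the coefficient of $x_c$ at $w$ is $1$ if $c$ is the type of
$w$ and $0$ otherwise (`stateCoeff_xElem`).

Second, two states of the same type lie in one $G_n$-orbit (`exists_actIndex_eq`), and the types
that occur are precisely the diagrams with at most $n$ parts (`Diagram.exists_ofState_eq_iff`).

An equivariant map is a function on states that is constant on orbits, hence a function of the type.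
Thus the $x_c$ with at most $n$ parts go to the indicator functions of the types, which gives
fullness, and every other $x_c$ goes to $0$. Since the $x_c$ span all of $\mathrm{Hom}(k,l)$,
reading off coefficients at states identifies the kernel. No division occurs, so any commutative
ring is allowed. -/

namespace GroupPartition

open CategoryTheory
open scoped Classical TensorProduct

universe u v

/-! ### States, their types and their orbits -/

section States

variable {G : Type v} [Group G] {n k l : ℕ}

/-- The diagram whose parts are the sets of vertices with equal index and whose labels are the
group components. It is the coarsest diagram admitting the given entries. -/
def Diagram.ofState (w : Vertex k l → Fin n × G) : Diagram G k l :=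
  Diagram.mk (Setoid.ker fun a => (w a).1) fun a => (w a).2

theorem Diagram.ofState_admits (w : Vertex k l → Fin n × G) : (Diagram.ofState w).Admits w :=
  fun _ _ h => ⟨h, by simp⟩

/-- Admitting $w$ makes $h_ag_a^{-1}$ constant on each part, which is the same as saying that the
labels $h$ and $g$ are equivalent. Hence $c$ and the type of $w$ have representatives with common
labels, and only their partitions remain to be compared. -/
theorem Diagram.Admits.mk_part_eq {c : Diagram G k l} {w : Vertex k l → Fin n × G}
    (h : c.Admits w) : Diagram.mk c.part (fun a => (w a).2) = c := by
  induction c using Diagram.ind with | h P g => ?_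
  refine Diagram.mk_eq_mk.2 ⟨rfl, Quotient.lift (fun a => g a * (w a).2⁻¹) ?_, ?_⟩
  · intro a b hab
    have h2 := (h a b hab).2
    -- The hypothesis concerns $h_ag_a^{-1}$, whereas the factor carrying $h$ to $g$ is its inverse
    -- $g_ah_a^{-1}$.
    rw [← inv_inj] at h2
    simpa using h2
  · intro a
    simp

theorem Diagram.Admits.part_le {c : Diagram G k l} {w : Vertex k l → Fin n × G}
    (h : c.Admits w) : c.part ≤ Setoid.ker fun a => (w a).1 := by
  induction c using Diagram.ind with | h P g => ?_
  exact fun a b hab => (h a b hab).1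

/-- Once $c$ is labelled by the group components of $w$, it is obtained from the type of $w$ by
refining the partition. This turns matrix coefficients into the zeta function of the order on
diagrams. -/
theorem Diagram.admits_iff_eq_or_strictlyFiner (c : Diagram G k l) (w : Vertex k l → Fin n × G) :
    c.Admits w ↔ c = Diagram.ofState w ∨ c.StrictlyFiner (Diagram.ofState w) := by
  constructor
  · intro h
    rcases h.part_le.eq_or_lt with h' | h'
    · left
      rw [← h.mk_part_eq, h', Diagram.ofState]
    · exact Or.inr ⟨_, _, _, h', h.mk_part_eq.symm, rfl⟩
  · rintro (rfl | ⟨P, Q, g, hPQ, rfl, hQ⟩)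
    · exact Diagram.ofState_admits w
    -- With the common labelling $g$, the conditions imposed by the finer $P$ are among those
    -- imposed by $Q$.
    · have h := Diagram.ofState_admits w
      rw [hQ] at h
      exact fun a b hab => h a b (hPQ.le hab)

theorem Diagram.not_strictlyFiner_self (c : Diagram G k l) : ¬ c.StrictlyFiner c :=
  fun h => (Diagram.part_lt h).ne rfl

/-- Diagrams with at most `n` parts are exactly those of the form `Diagram.ofState w`. -/
theorem Diagram.exists_ofState_eq_iff (c : Diagram G k l) :
    (∃ w : Vertex k l → Fin n × G, Diagram.ofState w = c) ↔ c.numParts ≤ n := by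
  constructor
  · rintro ⟨w, rfl⟩
    -- Distinct parts of a type carry distinct indices in `Fin n`.
    refine (Nat.card_le_card_of_injective
      (Quotient.lift (fun a => (w a).1) fun _ _ h => h) ?_).trans (Nat.card_fin n).le
    rintro ⟨a⟩ ⟨b⟩ h
    exact Quotient.sound h
  · intro h
    induction c using Diagram.ind with | h P g => ?_
    -- Giving the parts pairwise distinct indices yields a state whose index kernel is exactly $P$;
    -- this needs at most $n$ parts.
    have : Nonempty (Quotient P ↪ Fin n) := by
      have := Fintype.ofFinite (Quotient P)
      rw [Function.Embedding.nonempty_iff_card_le, Fintype.card_eq_nat_card, Fintype.card_fin]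
      exact h
    obtain ⟨ι⟩ := this
    refine ⟨fun a => (ι (Quotient.mk P a), g a), ?_⟩
    have hker : (Setoid.ker fun a => ι (Quotient.mk P a)) = P := by
      ext a b
      rw [Setoid.ker_def, ι.injective.eq_iff, Quotient.eq]
    simp only [Diagram.ofState, hker]

theorem Diagram.numParts_le (c : Diagram G k l) : c.numParts ≤ k + l :=
  (Nat.card_le_card_of_surjective _ (Quotient.mk_surjective (s := c.part))).trans (by simp)

/-- The bound $k+l$ on the number of parts is attained, which provides a kernel element as soon as
$k+l>n$. -/
theorem Diagram.numParts_mk_bot (g : Vertex k l → G) :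
    (Diagram.mk (⊥ : Setoid (Vertex k l)) g).numParts = k + l := by
  have e : Vertex k l ≃ Quotient (⊥ : Setoid (Vertex k l)) :=
    Equiv.ofBijective (Quotient.mk _)
      ⟨fun _ _ h => Quotient.exact h, Quotient.mk_surjective⟩
  exact (Nat.card_congr e).symm.trans (by simp)

/-- Entries of the same type lie in one orbit of the wreath product. -/
theorem exists_actIndex_eq {w w' : Vertex k l → Fin n × G}
    (h : Diagram.ofState w = Diagram.ofState w') :
    ∃ γ : Wreath G n, ∀ a, actIndex γ (w a) = w' a := by
  obtain ⟨hker, t, ht⟩ := Diagram.mk_eq_mk.1 h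
  dsimp only at hker t ht
  have hiff : ∀ a b, (w a).1 = (w b).1 ↔ (w' a).1 = (w' b).1 := fun a b => by
    rw [← Setoid.ker_def (f := fun a => (w a).1), hker, Setoid.ker_def]
  -- Both sets of occurring indices are identified with the common set of parts.
  let e : {i // i ∈ Set.range fun a => (w a).1} ≃ {i // i ∈ Set.range fun a => (w' a).1} :=
    (Setoid.quotientKerEquivRange _).symm.trans
      ((Quotient.congrRight fun a b => hiff a b).trans (Setoid.quotientKerEquivRange _))
  have he : ∀ a, (e ⟨(w a).1, a, rfl⟩ : Fin n) = (w' a).1 := fun a => by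
    have h1 : (Setoid.quotientKerEquivRange fun a => (w a).1).symm ⟨(w a).1, a, rfl⟩ =
        Quotient.mk _ a := (Equiv.symm_apply_eq _).2 rfl
    simp only [e, Equiv.trans_apply, h1]
    rfl
  -- The wreath product multiplies by the component at the target index, so the factor $t$ of a part
  -- is placed at its index in $w'$. Indices that do not occur in $w'$ get the arbitrary value $1$.
  let u : Fin n → G := fun i =>
    if hi : ∃ a, (w' a).1 = i then t (Quotient.mk _ hi.choose) else 1
  have hu : ∀ a, u (w' a).1 = t (Quotient.mk _ a) := fun a => by
    have hi : ∃ b, (w' b).1 = (w' a).1 := ⟨a, rfl⟩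
    simp only [u, dif_pos hi]
    exact congrArg t (Quotient.sound ((hiff _ _).2 hi.choose_spec))
  -- A bijection between two subsets of a finite set extends to a permutation of the whole set.
  refine ⟨⟨u, e.extendSubtype⟩, fun a => ?_⟩
  have h2 : e.extendSubtype (w a).1 = (w' a).1 := by
    rw [Equiv.extendSubtype_apply_of_mem e _ ⟨a, rfl⟩, he]
  refine Prod.ext h2 ?_
  change u (e.extendSubtype (w a).1) * (w a).2 = (w' a).2
  rw [h2, hu, ht]

end States

/-! ### Matrix coefficients of the elements $x_c$ -/

section Coefficients

variable (𝕜 : Type u) [CommRing 𝕜] {G : Type v} [Group G] {n k l : ℕ}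

/-- The matrix coefficient at the entries `w`, extended linearly to combinations of diagrams. -/
noncomputable def stateCoeff (w : Vertex k l → Fin n × G) : (Diagram G k l →₀ 𝕜) →ₗ[𝕜] 𝕜 :=
  Finsupp.linearCombination 𝕜 fun c => if c.Admits w then 1 else 0

theorem stateCoeff_single (w : Vertex k l → Fin n × G) (c : Diagram G k l) (r : 𝕜) :
    stateCoeff 𝕜 w (Finsupp.single c r) = r * if c.Admits w then 1 else 0 := by
  simp [stateCoeff]

/-- Möbius inversion: the coefficient of $c$ itself is the indicator of "equal to or finer than the
type of $w$", and subtracting the $x_{c'}$ with $c'>c$ removes the contribution of strict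
refinement. -/
theorem stateCoeff_xElem [Finite G] (w : Vertex k l → Fin n × G) (c : Diagram G k l) :
    stateCoeff 𝕜 w (xElem 𝕜 c) = if c = Diagram.ofState w then 1 else 0 := by
  -- The induction follows the recursion for $x_c$ towards coarser partitions, of which there are
  -- finitely many.
  induction hP : c.part using (wellFounded_gt (α := Setoid (Vertex k l))).induction
    generalizing c with
  | _ P ih =>
  subst hP
  rw [xElem_def, map_sub, map_sum, stateCoeff_single, one_mul,
    Finset.sum_congr rfl fun c' _ => ih c'.1.part (Diagram.part_lt c'.2) c'.1 rfl]
  -- By induction only $c'$ equal to the type of $w$ contributes, and it is a summand exactly when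
  -- it lies strictly above $c$.
  have hsum : (∑ c' : {c' : Diagram G k l // c.StrictlyFiner c'},
      if c'.1 = Diagram.ofState w then (1 : 𝕜) else 0) =
      if c.StrictlyFiner (Diagram.ofState w) then 1 else 0 := by
    split_ifs with h
    · rw [Fintype.sum_eq_single ⟨_, h⟩]
      · simp
      · intro c' hc'
        rw [if_neg fun h' => hc' (Subtype.ext h')]
    · refine Finset.sum_eq_zero fun c' _ => if_neg ?_
      intro h'
      exact h (h' ▸ c'.2)
  rw [hsum]
  -- The three cases $c$ equal to, strictly finer than, or neither give $1-0$, $1-1$ and $0-0$.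
  by_cases h : c = Diagram.ofState w
  · have h' := (Diagram.ofState w).not_strictlyFiner_self
    rw [if_pos h, h, if_pos (Diagram.ofState_admits w), if_neg h', sub_zero]
  · by_cases h' : c.StrictlyFiner (Diagram.ofState w) <;>
      simp [Diagram.admits_iff_eq_or_strictlyFiner, h, h']

theorem xElem_ne_zero [Finite G] [Nontrivial 𝕜] (c : Diagram G k l) : xElem 𝕜 c ≠ 0 := by
  intro h
  -- Here the number of indices is taken to be $k+l$, enough for every diagram to be the type of
  -- some state.
  obtain ⟨w, hw⟩ := c.exists_ofState_eq_iff.2 c.numParts_le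
  have := stateCoeff_xElem 𝕜 w c
  rw [h, map_zero, if_pos hw.symm] at this
  exact zero_ne_one this

/-- The change from diagrams to the $x_c$ is unitriangular: the recursion reads $c =
x_c+\sum_{c'>c}x_{c'}$. -/
theorem span_range_xElem [Finite G] :
    Submodule.span 𝕜 (Set.range (xElem 𝕜 : Diagram G k l → Diagram G k l →₀ 𝕜)) = ⊤ := by
  refine top_le_iff.1 ?_
  intro f _
  rw [← f.sum_single]
  refine Submodule.sum_mem _ fun c _ => ?_
  rw [← mul_one (f c), ← smul_eq_mul, ← Finsupp.smul_single]
  refine Submodule.smul_mem _ _ ?_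
  have h := xElem_def 𝕜 c
  rw [eq_sub_iff_add_eq] at h
  rw [← h]
  exact Submodule.add_mem _ (Submodule.subset_span ⟨c, rfl⟩)
    (Submodule.sum_mem _ fun c' _ => Submodule.subset_span ⟨c'.1, rfl⟩)

theorem exists_sum_smul_xElem [Finite G] (f : Diagram G k l →₀ 𝕜) :
    ∃ a : Diagram G k l → 𝕜, ∑ c, a c • xElem 𝕜 c = f :=
  (Submodule.mem_span_range_iff_exists_fun 𝕜).1 (span_range_xElem (G := G) 𝕜 ▸ Submodule.mem_top)

/-- States act as dual vectors to the $x_c$, but reach only those $c$ with at most $n$ parts. -/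
theorem stateCoeff_sum_smul_xElem [Finite G] (w : Vertex k l → Fin n × G)
    (a : Diagram G k l → 𝕜) :
    stateCoeff 𝕜 w (∑ c, a c • xElem 𝕜 c) = a (Diagram.ofState w) := by
  simp [map_sum, stateCoeff_xElem]

/-! ### Equivariant maps as functions on orbits of states -/

theorem repr_tensorRep (γ : Wreath G n) (v : ⨂[𝕜] _ : Fin l, PermModule 𝕜 G n)
    (y : Fin l → Fin n × G) :
    (tensorBasis 𝕜 G n l).repr (tensorRep 𝕜 G n l γ v) (fun a => actIndex γ (y a)) =
      (tensorBasis 𝕜 G n l).repr v y := by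
  refine LinearMap.congr_fun (f := (tensorBasis 𝕜 G n l).coord _ ∘ₗ tensorRep 𝕜 G n l γ)
    (g := (tensorBasis 𝕜 G n l).coord y) ((tensorBasis 𝕜 G n l).ext fun x => ?_) v
  have h : (fun a => actIndex γ (x a)) = (fun a => actIndex γ (y a)) ↔ x = y := by
    simp [funext_iff]
  rw [LinearMap.comp_apply, tensorBasis_apply, tensorRep_tensorVec, ← tensorBasis_apply,
    ← tensorBasis_apply, Module.Basis.coord_apply, Module.Basis.coord_apply,
    Module.Basis.repr_self, Module.Basis.repr_self, Finsupp.single_apply, Finsupp.single_apply]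
  simp only [h]

/-- The matrix coefficients of an equivariant map are constant on orbits. -/
theorem repr_hom_actIndex (f : Rep.of (tensorRep 𝕜 G n k) ⟶ Rep.of (tensorRep 𝕜 G n l))
    (γ : Wreath G n) (x : Fin k → Fin n × G) (y : Fin l → Fin n × G) :
    (tensorBasis 𝕜 G n l).repr (f.hom (tensorVec 𝕜 fun a => actIndex γ (x a)))
      (fun a => actIndex γ (y a)) = (tensorBasis 𝕜 G n l).repr (f.hom (tensorVec 𝕜 x)) y := by
  have h1 : f.hom (tensorVec 𝕜 fun a => actIndex γ (x a)) =
      tensorRep 𝕜 G n l γ (f.hom (tensorVec 𝕜 x)) := by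
    rw [← tensorRep_tensorVec]
    exact Rep.hom_comm_apply f γ (tensorVec 𝕜 x)
  rw [h1, repr_tensorRep]

/-! ### Kernel and image of the action map -/

variable [Fintype G]

theorem actionMap_tensorVec (f : Diagram G k l →₀ 𝕜) (x : Fin k → Fin n × G) :
    (actionMap 𝕜 n k l f).hom (tensorVec 𝕜 x) =
      ∑ y : Fin l → Fin n × G, stateCoeff 𝕜 (Sum.elim x y) f • tensorVec 𝕜 y := by
  induction f using Finsupp.induction_linear with
  | zero => simp
  | add f g hf hg =>
    simp only [map_add, add_smul, Finset.sum_add_distrib, ← hf, ← hg]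
    rfl
  | single c a =>
    have h : actionMap 𝕜 n k l (Finsupp.single c a) = a • diagramHom 𝕜 n c := by simp [actionMap]
    rw [h]
    change a • diagramMap 𝕜 n c (tensorVec 𝕜 x) = _
    simp only [diagramMap_tensorVec, stateCoeff_single, Finset.smul_sum, smul_smul]
    rfl

theorem repr_actionMap_tensorVec (f : Diagram G k l →₀ 𝕜) (x : Fin k → Fin n × G)
    (y : Fin l → Fin n × G) :
    (tensorBasis 𝕜 G n l).repr ((actionMap 𝕜 n k l f).hom (tensorVec 𝕜 x)) y =
      stateCoeff 𝕜 (Sum.elim x y) f := by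
  rw [actionMap_tensorVec]
  simp only [← tensorBasis_apply]
  rw [Module.Basis.repr_sum_self]

/-- The numbers `stateCoeff 𝕜 w f` are all the matrix entries of the image of $f$, the bottom half
of $w$ naming the column and the top half the row. -/
theorem actionMap_eq_zero_iff (f : Diagram G k l →₀ 𝕜) :
    actionMap 𝕜 n k l f = 0 ↔ ∀ w : Vertex k l → Fin n × G, stateCoeff 𝕜 w f = 0 := by
  constructor
  · intro h w
    rw [← Sum.elim_comp_inl_inr w, ← repr_actionMap_tensorVec, h]
    simp
  · intro h
    refine rep_hom_ext 𝕜 fun x => ?_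
    rw [actionMap_tensorVec]
    simp [h]

/-- Expand a kernel element in the $x_c$. Evaluation at a state of type $c$ kills the coefficient of
each $x_c$ with at most $n$ parts. Conversely, a diagram with more than $n$ parts is the type of no
state, so its $x_c$ has only zero entries. -/
theorem ker_actionMap :
    LinearMap.ker (actionMap 𝕜 n k l (G := G)) =
      Submodule.span 𝕜 {f | ∃ c : Diagram G k l, n < c.numParts ∧ f = xElem 𝕜 c} := by
  refine le_antisymm (fun f hf => ?_) (Submodule.span_le.2 ?_)
  · obtain ⟨a, rfl⟩ := exists_sum_smul_xElem 𝕜 f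
    refine Submodule.sum_mem _ fun c _ => ?_
    by_cases hc : n < c.numParts
    · exact Submodule.smul_mem _ _ (Submodule.subset_span ⟨c, hc, rfl⟩)
    · obtain ⟨w, rfl⟩ := c.exists_ofState_eq_iff.2 (not_lt.1 hc)
      have := (actionMap_eq_zero_iff 𝕜 _).1 hf w
      rw [stateCoeff_sum_smul_xElem] at this
      simp [this]
  · rintro _ ⟨c, hc, rfl⟩
    refine (actionMap_eq_zero_iff 𝕜 _).2 fun w => ?_
    rw [stateCoeff_xElem, if_neg]
    exact fun h => hc.not_ge (c.exists_ofState_eq_iff.1 ⟨w, h.symm⟩)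

/-- By equivariance the matrix entries of $f$ depend only on the type of the state, so they can
serve as the coefficients of a preimage in terms of the $x_c$. -/
theorem actionMap_surjective : Function.Surjective (actionMap 𝕜 n k l (G := G)) := by
  intro f
  let F : (Vertex k l → Fin n × G) → 𝕜 := fun w =>
    (tensorBasis 𝕜 G n l).repr (f.hom (tensorVec 𝕜 (w ∘ Sum.inl))) (w ∘ Sum.inr)
  have hF : ∀ w w' : Vertex k l → Fin n × G, Diagram.ofState w = Diagram.ofState w' →
      F w = F w' := by
    intro w w' h
    obtain ⟨γ, hγ⟩ := exists_actIndex_eq h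
    obtain rfl : (fun a => actIndex γ (w a)) = w' := funext hγ
    exact (repr_hom_actIndex 𝕜 f γ _ _).symm
  -- Diagrams that are not types get coefficient $0$; any value would do, since their $x_c$ lie in
  -- the kernel.
  refine ⟨∑ c, Function.extend Diagram.ofState F 0 c • xElem 𝕜 c, rep_hom_ext 𝕜 fun x => ?_⟩
  refine (tensorBasis 𝕜 G n l).repr.injective (Finsupp.ext fun y => ?_)
  rw [repr_actionMap_tensorVec, stateCoeff_sum_smul_xElem,
    Function.FactorsThrough.extend_apply (fun w w' h => hF w w' h)]
  rfl

theorem actionMap_bijective_iff [Nontrivial 𝕜] :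
    Function.Bijective (actionMap 𝕜 n k l (G := G)) ↔ k + l ≤ n := by
  rw [Function.Bijective, and_iff_left (actionMap_surjective 𝕜), ← LinearMap.ker_eq_bot,
    ker_actionMap, Submodule.span_eq_bot]
  constructor
  · intro h
    by_contra hn
    -- The partition into singletons has $k+l>n$ parts, so its nonzero $x_c$ would lie in the
    -- kernel.
    refine xElem_ne_zero 𝕜 (Diagram.mk ⊥ fun _ => (1 : G)) (h _ ⟨_, ?_, rfl⟩)
    rw [Diagram.numParts_mk_bot]
    exact not_le.1 hn
  · rintro h _ ⟨c, hc, rfl⟩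
    exact absurd (c.numParts_le.trans h) hc.not_ge

end Coefficients

end GroupPartition

/-- On morphisms the functor is `actionMap` by definition, and `xMor` unfolds to `xElem`, so the
statements about linear maps apply directly. -/
theorem theorem5p5 (𝕜 : Type*) [CommRing 𝕜] (G : Type*) [Group G] [Fintype G] (n : ℕ) :
    (GroupPartition.actionFunctor 𝕜 G n).Full ∧
    (∀ k l : ℕ,
      LinearMap.ker ((GroupPartition.actionFunctor 𝕜 G n).mapLinearMap 𝕜
          (X := GroupPartition.Par.ob k) (Y := GroupPartition.Par.ob l)) =
        Submodule.span 𝕜 {f | ∃ c : GroupPartition.Diagram G k l,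
          n < c.numParts ∧ f = GroupPartition.xMor ((n : 𝕜) * Fintype.card G) c}) ∧
    (Nontrivial 𝕜 → ∀ k l : ℕ,
      Function.Bijective ((GroupPartition.actionFunctor 𝕜 G n).mapLinearMap 𝕜
          (X := GroupPartition.Par.ob k) (Y := GroupPartition.Par.ob l)) ↔ k + l ≤ n) :=
  ⟨⟨fun f => GroupPartition.actionMap_surjective 𝕜 f⟩,
    fun _ _ => GroupPartition.ker_actionMap 𝕜,
    fun _ _ _ => GroupPartition.actionMap_bijective_iff 𝕜⟩
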